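/- Let $d\ge 0$ and $n\ge 1$ be integers, let $\mu$ be a probability distribution on $\mathbb{R}^d$ with finite second moments, let $\delta_1,\dots,\delta_n>0$ be step sizes, and let $f_1,\dots,f_n\colon\mathbb{R}^d\to\mathbb{R}^d$ be measurable functions. Define the comparison process by $Y_0=0$ and $$Y_k = Y_{k-1}+\delta_k X+\sqrt{\delta_k}\,N_k,\qquad k=1,\dots,n,$$ where $X\sim\mu$ is independent of $(N_1,\dots,N_n)$ and $N_1,\dots,N_n$ are independent standard Gaussian vectors in $\mathbb{R}^d$. Define the sampling process by $Z_0=0$ and $$Z_k = Z_{k-1}+\delta_k f_k(Z_{k-1})+\sqrt{\delta_k}\,\tilde N_k,\qquad k=1,\dots,n,$$ where $\tilde N_1,\dots,\tilde N_n$ are independent standard Gaussian vectors in $\mathbb{R}^d$. Assume that $\mathbb{E}\|f_k(Y_{k-1})\|^2<\infty$ for all $k=1,\dots,n$. Then the Kullback–Leibler divergence (with natural logarithm) $\Delta_n = D\big(\mathrm{Law}(Y_1,\dots,Y_n)\,\|\,\mathrm{Law}(Z_1,\dots,Z_n)\big)$ satisfies $$\Delta_n\le\frac{\delta_{\max}}{2}\operatorname{tr}(\operatorname{Cov}(X))+\sum_{k=1}^n\frac{\delta_k}{2}\,\mathbb{E}\big\|f_k(Y_{k-1})-\mathbb{E}[X\mid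 Y_{k-1}]\big\|^2,$$ where $\delta_{\max}=\max\{\delta_1,\dots,\delta_n\}$. The dimension $d$ does not appear explicitly in the bound. -/

import Mathlib

open MeasureTheory ProbabilityTheory

/-- The comparison process `Y₀ = 0`, `Y_k = Y_{k-1} + δ_k X + √δ_k N_k` for `k ≥ 1`
(the values of `δ` and `N` at `0` are not used). -/
noncomputable def comparisonProcess {Ω E : Type*} [AddCommGroup E] [Module ℝ E]
    (δ : ℕ → ℝ) (X : Ω → E) (N : ℕ → Ω → E) : ℕ → Ω → E
  | 0 => fun _ => 0
  | k + 1 => fun ω =>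
      comparisonProcess δ X N k ω + δ (k + 1) • X ω + √(δ (k + 1)) • N (k + 1) ω

/-- The sampling process `Z₀ = 0`, `Z_k = Z_{k-1} + δ_k f_k(Z_{k-1}) + √δ_k N_k` for `k ≥ 1`
(the values of `δ`, `f` and `N` at `0` are not used). -/
noncomputable def samplingProcess {Ω E : Type*} [AddCommGroup E] [Module ℝ E]
    (δ : ℕ → ℝ) (f : ℕ → E → E) (N : ℕ → Ω → E) : ℕ → Ω → E
  | 0 => fun _ => 0
  | k + 1 => fun ω =>
      samplingProcess δ f N k ω + δ (k + 1) • f (k + 1) (samplingProcess δ f N k ω)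
        + √(δ (k + 1)) • N (k + 1) ω

/-- The law of `(Y_1, …, Y_n)` for a process `Y_0, Y_1, …`; coordinate `k : Fin n` of the tuple
is `Y_{k+1}`. -/
noncomputable def pathLaw {Ω E : Type*} [MeasurableSpace Ω] [MeasurableSpace E]
    (P : Measure Ω) (Y : ℕ → Ω → E) (n : ℕ) : Measure (Fin n → E) :=
  P.map (fun ω (k : Fin n) => Y (k + 1) ω)

/-- The covariance matrix `Cov(X)` of a random vector `X` in `ℝ^d`. -/
noncomputable def covarianceMatrix {Ω : Type*} [MeasurableSpace Ω] {d : ℕ}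
    (X : Ω → EuclideanSpace ℝ (Fin d)) (P : Measure Ω) : Matrix (Fin d) (Fin d) ℝ :=
  Matrix.of fun i j => cov[fun ω => X ω i, fun ω => X ω j; P]

/-!
# Relative entropy of the Euler discretisation of a diffusion sampler

Both path laws are compared with the law of the driftless walk `B_k = √δ_1 N_1 + ⋯ + √δ_k N_k`. By
the Cameron-Martin formula, one step at a time (`map_pathUpTo_samplingProcess`), the law of `Z` has
density `exp (∑ ⟪f_k (b_{k-1}), b_k - b_{k-1}⟫ - δ_k / 2 ‖f_k (b_{k-1})‖²)`. Conditionally on `X = x`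
the process `Y` has the constant drift `x`, so that the sum telescopes; averaging over `X`, the law
of `Y` has density `p_{t_n} (b_n)`, where `t_k = δ_1 + ⋯ + δ_k` and
`p_t (w) = 𝔼 exp (⟪X, w⟫ - t / 2 ‖X‖²)` (`map_pathUpTo_comparisonProcess`). The divergence is the
expectation under `Y` of the logarithm of the quotient. The increments of `Y` are
`δ_k X + √δ_k N_k`, the noise is centred given the past, and `X` may be replaced by
`c_k = 𝔼[X | Y_{k-1}]`. Completing the square gives
`Δ_n ≤ F(t_n) - ∑ δ_k / 2 𝔼 ‖c_k‖² + ∑ δ_k / 2 𝔼 ‖f_k (Y_{k-1}) - c_k‖²`,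
where `F(t) = 𝔼 log p_t (V_t)` for `V_t = t X + √t N` with `N` standard Gaussian.

It remains to bound the entropy `F(t_n)` of the Gaussian channel. Let `a(t) = 𝔼 ‖𝔼[X | V_t]‖²`, so that
`𝔼 ‖c_k‖² = a(t_{k-1})` (only `≥` is needed, `posteriorEnergy_le_condExp`). The key inequality is
`F(t) - F(s) ≤ (t - s) / 2 · a(t)` for `s ≤ t` (`channelEntropy_le_add`), a form of the Gaussian
logarithmic Sobolev inequality. Since `a` is nondecreasing with `a(0) = ‖𝔼 X‖²` and `a ≤ 𝔼 ‖X‖²`,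
replacing `a(t_k)` by `a(t_{k-1})` in the sum over the steps costs at most
`δ_max / 2 · (a(t_n) - a(0)) ≤ δ_max / 2 · tr Cov X`, which is dimension-free.

For `X` of bounded support, the key inequality follows from its short-time version
`F(s + h) - F(s) ≤ h / 2 · a(s) + C h²` (`channelEntropy_add_le_of_bounded`) by subdividing
`[s, t]`, as `a` is monotone. The short-time version is conditional on `V_s`: under the posterior law
of `X`, with mean `m`, the law of the increment is compared with the Gaussian of mean `h m`, and the
chi-squared divergence of the two is of order `h²` since `X - m` is centred
(`channelEntropy_le_of_bounded`). The general case follows by truncating the law of `X` and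
dominated convergence.
-/

set_option linter.unusedSectionVars false

namespace DiffusionSampling

open Real InnerProductSpace
open scoped ENNReal RealInnerProductSpace

variable {E : Type*} [NormedAddCommGroup E] [InnerProductSpace ℝ E] [FiniteDimensional ℝ E]
  [MeasurableSpace E] [BorelSpace E]

/-! ### Scaled Gaussian measures and the Cameron-Martin density -/

variable (E) in
/-- The centred Gaussian measure with covariance `t • id`: the law of Brownian motion at
time `t`. -/
noncomputable def scaledGaussian (t : ℝ) : Measure E :=
  (stdGaussian E).map (fun z => √t • z)

/-- The Cameron-Martin density `exp (⟪x, w⟫ - t ‖x‖² / 2)` of the translate of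
`scaledGaussian E t` by `t • x`, with respect to `scaledGaussian E t`. -/
noncomputable def cmDensity (t : ℝ) (x w : E) : ℝ := exp (⟪x, w⟫ - t / 2 * ‖x‖ ^ 2)

instance (t : ℝ) : IsProbabilityMeasure (scaledGaussian E t) :=
  Measure.isProbabilityMeasure_map (by fun_prop)

lemma cmDensity_pos (t : ℝ) (x w : E) : 0 < cmDensity t x w := exp_pos _

lemma log_cmDensity (t : ℝ) (x w : E) : log (cmDensity t x w) = ⟪x, w⟫ - t / 2 * ‖x‖ ^ 2 :=
  log_exp _

lemma cmDensity_add (s h : ℝ) (x y w : E) :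
    cmDensity (s + h) x (y + w) = cmDensity s x y * cmDensity h x w := by
  simp only [cmDensity, ← exp_add, inner_add_right]
  ring_nf

lemma continuous_cmDensity (t : ℝ) : Continuous (fun z : E × E => cmDensity t z.1 z.2) := by
  unfold cmDensity
  fun_prop

@[fun_prop]
lemma measurable_cmDensity {α : Type*} [MeasurableSpace α] (t : ℝ) {f g : α → E}
    (hf : Measurable f) (hg : Measurable g) : Measurable (fun a => cmDensity t (f a) (g a)) :=
  (continuous_cmDensity t).measurable.comp (hf.prodMk hg)

/-- The Laplace transform of the standard Gaussian at the complex vector `x + i y`, as needed for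
the characteristic function of an exponentially tilted Gaussian. -/
lemma integral_cexp_stdGaussian (x y : E) :
    ∫ w, Complex.exp (⟪x, w⟫ + ⟪w, y⟫ * Complex.I) ∂(stdGaussian E) =
      Complex.exp ((‖x‖ ^ 2 - ‖y‖ ^ 2) / 2 + ⟪x, y⟫ * Complex.I) := by
  set b := stdOrthonormalBasis ℝ E with hb
  rw [stdGaussian, integral_map (Measurable.aemeasurable (by fun_prop))
    (Measurable.aestronglyMeasurable (by fun_prop))]
  have h1 : ∀ u : Fin (Module.finrank ℝ E) → ℝ,
      Complex.exp (⟪x, ∑ i, u i • b i⟫ + ⟪∑ i, u i • b i, y⟫ * Complex.I) =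
        ∏ i, Complex.exp ((⟪x, b i⟫ + ⟪b i, y⟫ * Complex.I) * u i) := by
    intro u
    rw [← Complex.exp_sum]
    congr 1
    simp only [inner_sum, sum_inner, real_inner_smul_left, real_inner_smul_right,
      Complex.ofReal_sum, Complex.ofReal_mul, Finset.sum_mul, ← Finset.sum_add_distrib]
    exact Finset.sum_congr rfl fun i _ => by ring
  simp_rw [← hb, h1]
  rw [integral_fintype_prod_eq_prod
    (f := fun i (u : ℝ) => Complex.exp ((⟪x, b i⟫ + ⟪b i, y⟫ * Complex.I) * u))]
  have h2 : ∀ z : ℂ,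
      ∫ u : ℝ, Complex.exp (z * u) ∂(gaussianReal 0 1) = Complex.exp (z ^ 2 / 2) := by
    intro z
    have := complexMGF_id_gaussianReal (μ := 0) (v := 1) z
    simpa [complexMGF] using this
  simp_rw [h2, ← Complex.exp_sum]
  congr 1
  have hx : (‖x‖ ^ 2 : ℝ) = ∑ i, ⟪x, b i⟫ ^ 2 := (b.sum_sq_inner_left x).symm
  have hy : (‖y‖ ^ 2 : ℝ) = ∑ i, ⟪b i, y⟫ ^ 2 := (b.sum_sq_inner_right y).symm
  have hxy : ⟪x, y⟫ = ∑ i, ⟪x, b i⟫ * ⟪b i, y⟫ := (b.sum_inner_mul_inner x y).symm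
  rw [← Complex.ofReal_pow, ← Complex.ofReal_pow, hx, hy, hxy]
  push_cast
  rw [← Finset.sum_sub_distrib, Finset.sum_mul, Finset.sum_div, ← Finset.sum_add_distrib]
  refine Finset.sum_congr rfl fun i _ => ?_
  ring_nf
  rw [Complex.I_sq]
  ring

lemma integrable_exp_inner_stdGaussian (x : E) :
    Integrable (fun w => exp ⟪x, w⟫) (stdGaussian E) := by
  have h : Integrable (fun w : E => Complex.exp (⟪x, w⟫ + ⟪w, (0 : E)⟫ * Complex.I))
      (stdGaussian E) := by
    by_contra hc
    have := integral_cexp_stdGaussian x 0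
    rw [integral_undef hc] at this
    exact Complex.exp_ne_zero _ this.symm
  refine h.norm.congr (ae_of_all _ fun w => ?_)
  simp [Complex.norm_exp]

lemma integrable_cmDensity_one (x : E) : Integrable (cmDensity 1 x) (stdGaussian E) := by
  refine ((integrable_exp_inner_stdGaussian x).mul_const (exp (-(1 / 2 * ‖x‖ ^ 2)))).congr
    (ae_of_all _ fun w => ?_)
  simp only [cmDensity, ← exp_add, sub_eq_add_neg]

lemma stdGaussian_map_add (x : E) :
    (stdGaussian E).map (fun w => w + x) =
      (stdGaussian E).withDensity (fun w => ENNReal.ofReal (cmDensity 1 x w)) := by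
  have : IsProbabilityMeasure ((stdGaussian E).map (fun w => w + x)) :=
    Measure.isProbabilityMeasure_map (by fun_prop)
  have : IsFiniteMeasure
      ((stdGaussian E).withDensity (fun w => ENNReal.ofReal (cmDensity 1 x w))) :=
    isFiniteMeasure_withDensity_ofReal (integrable_cmDensity_one x).2
  apply Measure.ext_of_charFun
  ext y
  rw [charFun_apply, charFun_apply, integral_map (by fun_prop)
    (Measurable.aestronglyMeasurable (by fun_prop)),
    integral_withDensity_eq_integral_toReal_smul (by fun_prop) (by simp)]
  have h1 := integral_cexp_stdGaussian 0 y
  have h2 := integral_cexp_stdGaussian x y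
  have e1 : ∀ w : E, Complex.exp (⟪w + x, y⟫ * Complex.I) =
      Complex.exp (⟪x, y⟫ * Complex.I) * Complex.exp (⟪(0 : E), w⟫ + ⟪w, y⟫ * Complex.I) := by
    intro w
    rw [← Complex.exp_add, inner_add_left]
    simp
    ring_nf
  have e2 : ∀ w : E, (ENNReal.ofReal (cmDensity 1 x w)).toReal • Complex.exp (⟪w, y⟫ * Complex.I) =
      Complex.exp (-(‖x‖ ^ 2 / 2)) * Complex.exp (⟪x, w⟫ + ⟪w, y⟫ * Complex.I) := by
    intro w
    rw [ENNReal.toReal_ofReal (cmDensity_pos _ _ _).le, Complex.real_smul, cmDensity,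
      Complex.ofReal_exp, ← Complex.exp_add, ← Complex.exp_add]
    push_cast
    ring_nf
  simp_rw [e1, e2, integral_const_mul, h1, h2, ← Complex.exp_add]
  congr 1
  simp
  ring

lemma lintegral_scaledGaussian {t : ℝ} {φ : E → ℝ≥0∞} (hφ : Measurable φ) :
    ∫⁻ w, φ w ∂(scaledGaussian E t) = ∫⁻ z, φ (√t • z) ∂(stdGaussian E) :=
  lintegral_map hφ (by fun_prop)

/-- **Cameron-Martin formula**. -/
lemma scaledGaussian_map_add {t : ℝ} (ht : 0 ≤ t) (x : E) :
    (scaledGaussian E t).map (fun w => w + t • x) =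
      (scaledGaussian E t).withDensity (fun w => ENNReal.ofReal (cmDensity t x w)) := by
  refine Measure.ext_of_lintegral _ fun φ hφ => ?_
  rw [lintegral_map hφ (by fun_prop), lintegral_withDensity_eq_lintegral_mul _ (by fun_prop) hφ,
    lintegral_scaledGaussian (by fun_prop),
    lintegral_scaledGaussian (by fun_prop)]
  have h := congrArg (fun ν => ∫⁻ w, φ (√t • w) ∂ν) (stdGaussian_map_add (√t • x))
  rw [lintegral_map (by fun_prop) (by fun_prop),
    lintegral_withDensity_eq_lintegral_mul _ (by fun_prop) (by fun_prop)] at h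
  simp only [Pi.mul_apply] at h ⊢
  convert! h using 4 with w w
  · rw [smul_add, smul_smul, mul_self_sqrt ht]
  · simp only [cmDensity, real_inner_smul_left, real_inner_smul_right, norm_smul,
      mul_pow, norm_eq_abs, sq_abs, sq_sqrt ht]
    ring_nf

lemma lintegral_mul_cmDensity {t : ℝ} (ht : 0 ≤ t) (x : E) {φ : E → ℝ≥0∞} (hφ : Measurable φ) :
    ∫⁻ w, ENNReal.ofReal (cmDensity t x w) * φ w ∂(scaledGaussian E t) =
      ∫⁻ w, φ (w + t • x) ∂(scaledGaussian E t) := by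
  rw [← lintegral_map hφ (by fun_prop), scaledGaussian_map_add ht,
    lintegral_withDensity_eq_lintegral_mul _ (by fun_prop) hφ]
  rfl

lemma integral_cmDensity_smul {F : Type*} [NormedAddCommGroup F] [NormedSpace ℝ F]
    {t : ℝ} (ht : 0 ≤ t) (x : E) {φ : E → F} (hφ : StronglyMeasurable φ) :
    ∫ w, cmDensity t x w • φ w ∂(scaledGaussian E t) =
      ∫ w, φ (w + t • x) ∂(scaledGaussian E t) := by
  rw [← integral_map (by fun_prop) hφ.aestronglyMeasurable, scaledGaussian_map_add ht,
    integral_withDensity_eq_integral_toReal_smul (by fun_prop) (by simp)]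
  simp_rw [ENNReal.toReal_ofReal (cmDensity_pos _ _ _).le]

lemma integral_cmDensity {t : ℝ} (ht : 0 ≤ t) (x : E) :
    ∫ w, cmDensity t x w ∂(scaledGaussian E t) = 1 := by
  have := integral_cmDensity_smul ht x (φ := fun _ => (1 : ℝ)) stronglyMeasurable_const
  simpa using this

lemma memLp_id_scaledGaussian (t : ℝ) : MemLp id 2 (scaledGaussian E t) := by
  rw [scaledGaussian, memLp_map_measure_iff (by fun_prop) (by fun_prop)]
  exact (IsGaussian.memLp_two_id (μ := stdGaussian E)).const_smul (√t)

lemma integrable_id_scaledGaussian (t : ℝ) : Integrable (fun w : E => w) (scaledGaussian E t) :=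
  (memLp_id_scaledGaussian t).integrable (by norm_num)

lemma integral_id_scaledGaussian (t : ℝ) : ∫ w, w ∂(scaledGaussian E t) = 0 := by
  rw [scaledGaussian, integral_map (by fun_prop) (by fun_prop), integral_smul,
    integral_id_stdGaussian, smul_zero]

/-- The increments of Brownian motion are independent and stationary, at the level of laws. -/
lemma scaledGaussian_conv {s h : ℝ} (hs : 0 ≤ s) (hh : 0 ≤ h) :
    ((scaledGaussian E s).prod (scaledGaussian E h)).map (fun z => z.1 + z.2) =
      scaledGaussian E (s + h) := by
  change Measure.conv _ _ = _
  apply Measure.ext_of_charFun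
  ext y
  rw [charFun_conv]
  simp only [scaledGaussian, charFun_map_smul, charFun_stdGaussian, ← Complex.exp_add]
  congr 1
  rw [norm_smul, norm_smul, norm_smul]
  simp only [norm_eq_abs, abs_of_nonneg (sqrt_nonneg _)]
  rw [← Complex.ofReal_pow, ← Complex.ofReal_pow, ← Complex.ofReal_pow, mul_pow, mul_pow, mul_pow,
    sq_sqrt hs, sq_sqrt hh, sq_sqrt (add_nonneg hs hh)]
  push_cast
  ring

lemma integrable_exp_mul_norm_scaledGaussian (t c : ℝ) :
    Integrable (fun w => exp (c * ‖w‖)) (scaledGaussian E t) := by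
  rw [scaledGaussian, integrable_map_measure (Measurable.aestronglyMeasurable (by fun_prop))
    (by fun_prop)]
  obtain ⟨C, hC, hi⟩ := IsGaussian.exists_integrable_exp_sq (stdGaussian E)
  refine (hi.const_mul (exp ((|c| * √t) ^ 2 / (4 * C)))).mono'
    (Measurable.aestronglyMeasurable (by fun_prop)) (ae_of_all _ fun w => ?_)
  simp only [Function.comp_apply, norm_eq_abs, abs_exp, ← exp_add, norm_smul]
  rw [exp_le_exp, abs_of_nonneg (sqrt_nonneg t)]
  have h1 : c * (√t * ‖w‖) ≤ (|c| * √t) * ‖w‖ := by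
    rw [mul_assoc]; gcongr; exact le_abs_self c
  have h2 : (|c| * √t) ^ 2 / (4 * C) + C * ‖w‖ ^ 2 - (|c| * √t) * ‖w‖ =
      (|c| * √t - 2 * C * ‖w‖) ^ 2 / (4 * C) := by
    field_simp; ring
  have h3 : 0 ≤ (|c| * √t - 2 * C * ‖w‖) ^ 2 / (4 * C) := by positivity
  linarith

/-! ### The Gaussian channel: marginal density, relative entropy and posterior energy -/

/-- The density at `w`, with respect to `scaledGaussian E t`, of `t X + √t N` for `X ∼ μ`
independent of the standard Gaussian `N`. -/
noncomputable def channelDensity (μ : Measure E) (t : ℝ) (w : E) : ℝ := ∫ x, cmDensity t x w ∂μ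

/-- The unnormalised posterior mean: `channelMoment μ t w / channelDensity μ t w` is the mean of
`X ∼ μ` conditionally on `t X + √t N = w`. -/
noncomputable def channelMoment (μ : Measure E) (t : ℝ) (w : E) : E :=
  ∫ x, cmDensity t x w • x ∂μ

/-- For a probability measure `μ`, the relative entropy of the law of `t X + √t N` with respect to
the law of `√t N`. -/
noncomputable def channelEntropy (μ : Measure E) (t : ℝ) : ℝ :=
  ∫ w, channelDensity μ t w * log (channelDensity μ t w) ∂(scaledGaussian E t)

/-- For a probability measure `μ`, the second moment `𝔼 ‖𝔼[X | t X + √t N]‖²` of the posterior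
mean. -/
noncomputable def posteriorEnergy (μ : Measure E) (t : ℝ) : ℝ :=
  ∫ w, ‖channelMoment μ t w‖ ^ 2 / channelDensity μ t w ∂(scaledGaussian E t)

/-- Joint convexity of `(b, a) ↦ ‖b‖² / a`, in integral form. -/
lemma norm_sq_integral_div_le {α F : Type*} [MeasurableSpace α] [NormedAddCommGroup F]
    [InnerProductSpace ℝ F] [CompleteSpace F] {ν : Measure α} {a : α → ℝ} {b : α → F}
    (ha : ∀ᵐ x ∂ν, 0 < a x) (hai : Integrable a ν) (hbi : Integrable b ν)
    (hi : Integrable (fun x => ‖b x‖ ^ 2 / a x) ν) :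
    ‖∫ x, b x ∂ν‖ ^ 2 / ∫ x, a x ∂ν ≤ ∫ x, ‖b x‖ ^ 2 / a x ∂ν := by
  have h0 : 0 ≤ ∫ x, a x ∂ν := integral_nonneg_of_ae (ha.mono fun x hx => hx.le)
  rcases h0.eq_or_lt with h0 | h0
  · rw [← h0, div_zero]
    exact integral_nonneg_of_ae (ha.mono fun x hx => by positivity)
  -- integrate the tangent inequality `‖b‖² / a ≥ 2 ⟪m, b⟫ - ‖m‖² a` at `m = ∫ b / ∫ a`
  set m : F := (∫ x, a x ∂ν)⁻¹ • ∫ x, b x ∂ν with hm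
  have h1 : ∫ x, (2 * ⟪m, b x⟫ - ‖m‖ ^ 2 * a x) ∂ν ≤ ∫ x, ‖b x‖ ^ 2 / a x ∂ν := by
    refine integral_mono_ae (((hbi.const_inner m).const_mul 2).sub (hai.const_mul _)) hi ?_
    filter_upwards [ha] with x hx
    rw [le_div_iff₀ hx]
    have h2 : 0 ≤ ‖b x - a x • m‖ ^ 2 := by positivity
    rw [norm_sub_sq_real, norm_smul, real_inner_smul_right, mul_pow, norm_eq_abs, sq_abs,
      real_inner_comm] at h2
    nlinarith
  refine le_trans (le_of_eq ?_) h1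
  rw [integral_sub ((hbi.const_inner m).const_mul 2) (hai.const_mul _), integral_const_mul,
    integral_const_mul, integral_inner hbi, hm, real_inner_smul_left, real_inner_self_eq_norm_sq,
    norm_smul, mul_pow, norm_eq_abs, sq_abs]
  field_simp
  ring

/-- The joint law of `(X, t X + √t N)`, described as a translate of a product and by its density. -/
lemma prod_scaledGaussian_map (μ : Measure E) [IsFiniteMeasure μ] {t : ℝ} (ht : 0 ≤ t) :
    (μ.prod (scaledGaussian E t)).map (fun z => (z.1, z.2 + t • z.1)) =
      (μ.prod (scaledGaussian E t)).withDensity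
        (fun z => ENNReal.ofReal (cmDensity t z.1 z.2)) := by
  refine Measure.ext_of_lintegral _ fun φ hφ => ?_
  rw [lintegral_map hφ (by fun_prop), lintegral_withDensity_eq_lintegral_mul _ (by fun_prop) hφ,
    lintegral_prod _ (by fun_prop), lintegral_prod _ (by fun_prop)]
  refine lintegral_congr fun x => ?_
  exact (lintegral_mul_cmDensity ht x (φ := fun w => φ (x, w)) (by fun_prop)).symm

section Joint

variable {μ : Measure E} [IsFiniteMeasure μ] {t : ℝ} {F : Type*} [NormedAddCommGroup F]
  [NormedSpace ℝ F]

lemma integrable_joint_iff (ht : 0 ≤ t) {φ : E × E → F} (hφ : StronglyMeasurable φ) :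
    Integrable (fun z => cmDensity t z.1 z.2 • φ z) (μ.prod (scaledGaussian E t)) ↔
      Integrable (fun z => φ (z.1, z.2 + t • z.1)) (μ.prod (scaledGaussian E t)) := by
  have h1 := integrable_map_measure (μ := μ.prod (scaledGaussian E t))
    (f := fun z => (z.1, z.2 + t • z.1)) (g := φ) hφ.aestronglyMeasurable (by fun_prop)
  rw [prod_scaledGaussian_map μ ht, integrable_withDensity_iff_integrable_smul' (by fun_prop)
    (by simp)] at h1
  simp_rw [ENNReal.toReal_ofReal (cmDensity_pos _ _ _).le] at h1
  exact h1

lemma integral_joint (ht : 0 ≤ t) {φ : E × E → F} (hφ : StronglyMeasurable φ) :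
    ∫ z, cmDensity t z.1 z.2 • φ z ∂(μ.prod (scaledGaussian E t)) =
      ∫ z, φ (z.1, z.2 + t • z.1) ∂(μ.prod (scaledGaussian E t)) := by
  rw [← integral_map (φ := fun z : E × E => (z.1, z.2 + t • z.1)) (by fun_prop)
    hφ.aestronglyMeasurable, prod_scaledGaussian_map μ ht,
    integral_withDensity_eq_integral_toReal_smul (by fun_prop) (by simp)]
  simp_rw [ENNReal.toReal_ofReal (cmDensity_pos _ _ _).le]

lemma integrable_joint_comp_fst (ht : 0 ≤ t) {g : E → F} (hg : StronglyMeasurable g)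
    (hgi : Integrable g μ) :
    Integrable (fun z => cmDensity t z.1 z.2 • g z.1) (μ.prod (scaledGaussian E t)) :=
  (integrable_joint_iff ht (φ := fun z => g z.1) (hg.comp_measurable measurable_fst)).2
    (hgi.comp_fst (scaledGaussian E t))

lemma ae_integrable_cmDensity_smul (ht : 0 ≤ t) {g : E → F} (hg : StronglyMeasurable g)
    (hgi : Integrable g μ) :
    ∀ᵐ w ∂(scaledGaussian E t), Integrable (fun x => cmDensity t x w • g x) μ :=
  (integrable_joint_comp_fst ht hg hgi).prod_left_ae

lemma integral_integral_cmDensity_smul (ht : 0 ≤ t) {g : E → F} (hg : StronglyMeasurable g)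
    (hgi : Integrable g μ) :
    ∫ w, ∫ x, cmDensity t x w • g x ∂μ ∂(scaledGaussian E t) = ∫ x, g x ∂μ := by
  rw [← integral_prod_symm _ (integrable_joint_comp_fst ht hg hgi),
    integral_joint ht (φ := fun z => g z.1) (hg.comp_measurable measurable_fst)]
  exact (integral_fun_fst _).trans (by simp)

end Joint

section Channel

variable {μ : Measure E} [IsFiniteMeasure μ] {t : ℝ}

lemma integrable_id_of_sq (hμ : Integrable (fun x => ‖x‖ ^ 2) μ) : Integrable (fun x => x) μ :=
  ((memLp_two_iff_integrable_sq_norm (f := fun x : E => x) (by fun_prop)).2 hμ).integrable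
    (by norm_num)

lemma stronglyMeasurable_channelDensity (μ : Measure E) [IsFiniteMeasure μ] (t : ℝ) :
    StronglyMeasurable (channelDensity μ t) :=
  StronglyMeasurable.integral_prod_left (f := fun x w => cmDensity t x w)
    (continuous_cmDensity t).stronglyMeasurable

@[fun_prop]
lemma measurable_channelDensity (μ : Measure E) [IsFiniteMeasure μ] (t : ℝ) :
    Measurable (channelDensity μ t) := (stronglyMeasurable_channelDensity μ t).measurable

lemma stronglyMeasurable_channelMoment (μ : Measure E) [IsFiniteMeasure μ] (t : ℝ) :
    StronglyMeasurable (channelMoment μ t) :=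
  StronglyMeasurable.integral_prod_left (f := fun x w => cmDensity t x w • x)
    ((continuous_cmDensity t).smul continuous_fst).stronglyMeasurable

@[fun_prop]
lemma measurable_channelMoment (μ : Measure E) [IsFiniteMeasure μ] (t : ℝ) :
    Measurable (channelMoment μ t) := (stronglyMeasurable_channelMoment μ t).measurable

lemma channelDensity_nonneg (μ : Measure E) (t : ℝ) (w : E) : 0 ≤ channelDensity μ t w :=
  integral_nonneg fun _ => (cmDensity_pos _ _ _).le

lemma ae_integrable_cmDensity (μ : Measure E) [IsFiniteMeasure μ] (ht : 0 ≤ t) :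
    ∀ᵐ w ∂(scaledGaussian E t), Integrable (fun x => cmDensity t x w) μ := by
  simpa using ae_integrable_cmDensity_smul (μ := μ) ht (g := fun _ => (1 : ℝ))
    stronglyMeasurable_const (integrable_const _)

lemma channelDensity_pos [NeZero μ] {w : E} (h : Integrable (fun x => cmDensity t x w) μ) :
    0 < channelDensity μ t w := by
  rw [channelDensity, integral_pos_iff_support_of_nonneg (fun x => (cmDensity_pos _ _ _).le) h]
  have : Function.support (fun x => cmDensity t x w) = Set.univ :=
    Set.eq_univ_of_forall fun x => (cmDensity_pos _ _ _).ne'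
  rw [this]
  exact Measure.measure_univ_pos.2 (NeZero.ne μ)

lemma ae_channelDensity_pos [NeZero μ] (ht : 0 ≤ t) :
    ∀ᵐ w ∂(scaledGaussian E t), 0 < channelDensity μ t w :=
  (ae_integrable_cmDensity μ ht).mono fun _ h => channelDensity_pos h

lemma integrable_channelDensity (ht : 0 ≤ t) :
    Integrable (channelDensity μ t) (scaledGaussian E t) := by
  have h := (integrable_joint_comp_fst (μ := μ) ht (g := fun _ => (1 : ℝ))
    stronglyMeasurable_const (integrable_const _)).integral_prod_right
  simp only [smul_eq_mul, mul_one] at h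
  exact h

lemma integral_channelDensity (ht : 0 ≤ t) :
    ∫ w, channelDensity μ t w ∂(scaledGaussian E t) = μ.real Set.univ := by
  have h := integral_integral_cmDensity_smul (μ := μ) ht (g := fun _ => (1 : ℝ))
    stronglyMeasurable_const (integrable_const _)
  simp only [smul_eq_mul, mul_one, integral_const] at h
  exact h

lemma integrable_channelMoment (ht : 0 ≤ t) (hμ : Integrable (fun x => ‖x‖ ^ 2) μ) :
    Integrable (channelMoment μ t) (scaledGaussian E t) :=
  (integrable_joint_comp_fst (μ := μ) ht (g := fun x => x)
    stronglyMeasurable_id (integrable_id_of_sq hμ)).integral_prod_right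

lemma integrable_integral_cmDensity_mul_sq (ht : 0 ≤ t) (hμ : Integrable (fun x => ‖x‖ ^ 2) μ) :
    Integrable (fun w => ∫ x, cmDensity t x w * ‖x‖ ^ 2 ∂μ) (scaledGaussian E t) :=
  (integrable_joint_comp_fst (μ := μ) ht (g := fun x => ‖x‖ ^ 2)
    (by fun_prop) hμ).integral_prod_right

lemma ae_norm_channelMoment_sq_div_le (ht : 0 ≤ t) (hμ : Integrable (fun x => ‖x‖ ^ 2) μ) :
    ∀ᵐ w ∂(scaledGaussian E t), ‖channelMoment μ t w‖ ^ 2 / channelDensity μ t w ≤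
      ∫ x, cmDensity t x w * ‖x‖ ^ 2 ∂μ := by
  filter_upwards [ae_integrable_cmDensity μ ht,
    ae_integrable_cmDensity_smul ht (g := fun x => x) stronglyMeasurable_id
      (integrable_id_of_sq hμ),
    ae_integrable_cmDensity_smul ht (g := fun x => ‖x‖ ^ 2) (by fun_prop) hμ] with w h1 h2 h3
  have e : ∀ x : E, ‖cmDensity t x w • x‖ ^ 2 / cmDensity t x w = cmDensity t x w * ‖x‖ ^ 2 := by
    intro x
    have := (cmDensity_pos t x w).ne'
    rw [norm_smul, mul_pow, norm_eq_abs, sq_abs]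
    field_simp
  have h := norm_sq_integral_div_le (ae_of_all μ fun x => cmDensity_pos t x w) h1 h2
    (by simpa only [e, smul_eq_mul] using h3)
  simp only [e] at h
  exact h

lemma integrable_posteriorEnergy (ht : 0 ≤ t) (hμ : Integrable (fun x => ‖x‖ ^ 2) μ) :
    Integrable (fun w => ‖channelMoment μ t w‖ ^ 2 / channelDensity μ t w)
      (scaledGaussian E t) := by
  refine (integrable_integral_cmDensity_mul_sq ht hμ).mono'
    (Measurable.aestronglyMeasurable (by fun_prop)) ?_
  filter_upwards [ae_norm_channelMoment_sq_div_le ht hμ] with w hw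
  rwa [norm_of_nonneg (div_nonneg (by positivity) (channelDensity_nonneg _ _ _))]

lemma posteriorEnergy_le (ht : 0 ≤ t) (hμ : Integrable (fun x => ‖x‖ ^ 2) μ) :
    posteriorEnergy μ t ≤ ∫ x, ‖x‖ ^ 2 ∂μ := by
  rw [← integral_integral_cmDensity_smul ht (by fun_prop) hμ]
  exact integral_mono_ae (integrable_posteriorEnergy ht hμ)
    (integrable_integral_cmDensity_mul_sq ht hμ) (ae_norm_channelMoment_sq_div_le ht hμ)

lemma integrable_cmDensity_mul_log (ht : 0 ≤ t) (hμ : Integrable (fun x => ‖x‖ ^ 2) μ) :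
    Integrable (fun z : E × E => cmDensity t z.1 z.2 * log (cmDensity t z.1 z.2))
      (μ.prod (scaledGaussian E t)) := by
  simp_rw [log_cmDensity]
  refine (integrable_joint_iff ht (φ := fun z : E × E => ⟪z.1, z.2⟫ - t / 2 * ‖z.1‖ ^ 2)
    (Continuous.stronglyMeasurable (by fun_prop))).2 ?_
  have h1 : Integrable (fun z : E × E => ‖z.1‖ ^ 2) (μ.prod (scaledGaussian E t)) :=
    hμ.comp_fst (scaledGaussian E t)
  have h2 : Integrable (fun z : E × E => ⟪z.1, z.2⟫) (μ.prod (scaledGaussian E t)) := by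
    refine (((integrable_id_of_sq hμ).norm).mul_prod
      (integrable_id_scaledGaussian t).norm).mono'
      (Continuous.aestronglyMeasurable (by fun_prop)) (ae_of_all _ fun z => ?_)
    exact norm_inner_le_norm _ _
  refine (h2.add (h1.const_mul (t / 2))).congr (ae_of_all _ fun z => ?_)
  simp only [Pi.add_apply, inner_add_right, real_inner_smul_right, real_inner_self_eq_norm_sq]
  ring

/-- Pointwise bounds on the entropy integrand, uniform over all sub-probability measures `ν ≤ μ`. -/
lemma abs_channelDensity_mul_log_le {ν : Measure E} (hν : ν ≤ μ) (hν1 : ν Set.univ ≤ 1) {w : E}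
    (h1 : Integrable (fun x => cmDensity t x w) μ)
    (h2 : Integrable (fun x => cmDensity t x w * log (cmDensity t x w)) μ) :
    |channelDensity ν t w * log (channelDensity ν t w)| ≤
      1 + ∫ x, |cmDensity t x w * log (cmDensity t x w)| ∂μ := by
  set p := channelDensity ν t w with hp
  have hp0 : 0 ≤ p := channelDensity_nonneg _ _ _
  have hI : 0 ≤ ∫ x, |cmDensity t x w * log (cmDensity t x w)| ∂μ :=
    integral_nonneg fun _ => abs_nonneg _
  rcases hp0.eq_or_lt with h0 | h0
  · rw [← h0, zero_mul, abs_zero]; linarith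
  have : IsFiniteMeasure ν := ⟨hν1.trans_lt (by simp)⟩
  have h1' := h1.mono_measure hν
  have h2' := h2.mono_measure hν
  have hlow : -1 ≤ p * log p := by
    have := one_sub_inv_le_log_of_pos h0
    have h3 : p * (1 - p⁻¹) ≤ p * log p := by gcongr
    rw [mul_sub, mul_inv_cancel₀ h0.ne'] at h3
    linarith
  -- integrate the tangent inequality `a log a ≥ a log p + a - p`
  have hup : p * log p ≤ ∫ x, cmDensity t x w * log (cmDensity t x w) ∂ν := by
    have h4 : ∫ x, (cmDensity t x w * (log p + 1) - p) ∂ν ≤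
        ∫ x, cmDensity t x w * log (cmDensity t x w) ∂ν := by
      refine integral_mono ((h1'.mul_const _).sub (integrable_const _)) h2' fun x => ?_
      have ha := cmDensity_pos t x w
      have := one_sub_inv_le_log_of_pos (div_pos ha h0)
      rw [log_div ha.ne' h0.ne', inv_div] at this
      have h5 := mul_le_mul_of_nonneg_left this ha.le
      have h6 : cmDensity t x w * (1 - p / cmDensity t x w) = cmDensity t x w - p := by
        field_simp
      simp only
      nlinarith
    rw [integral_sub (h1'.mul_const _) (integrable_const _), integral_mul_const, integral_const,
      smul_eq_mul] at h4
    have h7 : ν.real Set.univ ≤ 1 := ENNReal.toReal_le_of_le_ofReal zero_le_one (by simpa using hν1)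
    change p * (log p + 1) - _ ≤ _ at h4
    nlinarith
  have h8 : ∫ x, cmDensity t x w * log (cmDensity t x w) ∂ν ≤
      ∫ x, |cmDensity t x w * log (cmDensity t x w)| ∂μ :=
    (integral_mono h2' h2'.abs fun x => le_abs_self _).trans
      (integral_mono_measure hν (ae_of_all _ fun _ => abs_nonneg _) h2.abs)
  rw [abs_le]
  constructor <;> linarith

lemma integrable_one_add_integral_abs (ht : 0 ≤ t) (hμ : Integrable (fun x => ‖x‖ ^ 2) μ) :
    Integrable (fun w => 1 + ∫ x, |cmDensity t x w * log (cmDensity t x w)| ∂μ)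
      (scaledGaussian E t) :=
  (integrable_const 1).add (integrable_cmDensity_mul_log ht hμ).abs.integral_prod_right

lemma ae_abs_channelDensity_mul_log_le (ht : 0 ≤ t) (hμ : Integrable (fun x => ‖x‖ ^ 2) μ) :
    ∀ᵐ w ∂(scaledGaussian E t), ∀ ν : Measure E, ν ≤ μ → ν Set.univ ≤ 1 →
      |channelDensity ν t w * log (channelDensity ν t w)| ≤
        1 + ∫ x, |cmDensity t x w * log (cmDensity t x w)| ∂μ := by
  filter_upwards [ae_integrable_cmDensity μ ht,
    (integrable_cmDensity_mul_log ht hμ).prod_left_ae] with w h1 h2 ν hν hν1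
  exact abs_channelDensity_mul_log_le hν hν1 h1 h2

lemma integrable_channelDensity_mul_log (ht : 0 ≤ t) (hμ : Integrable (fun x => ‖x‖ ^ 2) μ)
    (hμ1 : μ Set.univ ≤ 1) :
    Integrable (fun w => channelDensity μ t w * log (channelDensity μ t w))
      (scaledGaussian E t) := by
  refine (integrable_one_add_integral_abs ht hμ).mono'
    (Measurable.aestronglyMeasurable (by fun_prop)) ?_
  filter_upwards [ae_abs_channelDensity_mul_log_le ht hμ] with w h
  exact h μ le_rfl hμ1

lemma integral_channelDensity_smul {F : Type*} [NormedAddCommGroup F] [NormedSpace ℝ F]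
    [CompleteSpace F] (ht : 0 ≤ t) {φ : E → F} (hφ : StronglyMeasurable φ)
    (hi : Integrable (fun z : E × E => φ (z.2 + t • z.1)) (μ.prod (scaledGaussian E t))) :
    Integrable (fun w => channelDensity μ t w • φ w) (scaledGaussian E t) ∧
      ∫ w, channelDensity μ t w • φ w ∂(scaledGaussian E t) =
        ∫ z, φ (z.2 + t • z.1) ∂(μ.prod (scaledGaussian E t)) := by
  have hm : StronglyMeasurable (fun z : E × E => φ z.2) := hφ.comp_measurable measurable_snd
  have h := (integrable_joint_iff ht hm).2 hi
  have e : ∀ w, channelDensity μ t w • φ w = ∫ x, cmDensity t x w • φ w ∂μ := fun w =>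
    (integral_smul_const _ _).symm
  simp_rw [e]
  refine ⟨h.integral_prod_right, ?_⟩
  rw [← integral_prod_symm _ h, integral_joint ht hm]

end Channel

/-! ### Entropy growth for boundedly supported measures -/

section Bounded

variable {μ : Measure E} [IsFiniteMeasure μ] {R s h : ℝ}

lemma integrable_sq_of_bounded (hR : ∀ᵐ x ∂μ, ‖x‖ ≤ R) : Integrable (fun x => ‖x‖ ^ 2) μ := by
  refine Integrable.of_bound (by fun_prop) (R ^ 2) (hR.mono fun x hx => ?_)
  rw [norm_of_nonneg (by positivity)]
  gcongr

lemma cmDensity_le {x w : E} (hh : 0 ≤ h) (hx : ‖x‖ ≤ R) : cmDensity h x w ≤ exp (R * ‖w‖) := by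
  refine exp_le_exp.2 ?_
  have h1 : ⟪x, w⟫ ≤ ‖x‖ * ‖w‖ := real_inner_le_norm _ _
  have h2 : ‖x‖ * ‖w‖ ≤ R * ‖w‖ := by gcongr
  have h3 : 0 ≤ h / 2 * ‖x‖ ^ 2 := by positivity
  linarith

lemma integrable_cmDensity_of_bounded (hR : ∀ᵐ x ∂μ, ‖x‖ ≤ R) (hs : 0 ≤ s) (w : E) :
    Integrable (fun x => cmDensity s x w) μ := by
  refine Integrable.of_bound (Measurable.aestronglyMeasurable (by fun_prop)) (exp (R * ‖w‖))
    (hR.mono fun x hx => ?_)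
  rw [norm_of_nonneg (cmDensity_pos _ _ _).le]
  exact cmDensity_le hs hx

/-- The entropy of a channel over a short time `h` is at most `h / 2` times the squared norm of the
mean, up to a quadratic error. -/
lemma channelEntropy_le_of_bounded {ν : Measure E} [IsProbabilityMeasure ν]
    (hR : ∀ᵐ x ∂ν, ‖x‖ ≤ R) (hh : 0 ≤ h) (hhR : h * (4 * R ^ 2) ≤ 1) :
    channelEntropy ν h ≤ h / 2 * ‖∫ x, x ∂ν‖ ^ 2 + (h * (4 * R ^ 2)) ^ 2 := by
  set m : E := ∫ x, x ∂ν with hm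
  have hsq := integrable_sq_of_bounded hR
  have hid := integrable_id_of_sq hsq
  have hmR : ‖m‖ ≤ R := by
    have := norm_integral_le_of_norm_le_const hR
    simpa using this
  have hR0 : 0 ≤ R := (norm_nonneg m).trans hmR
  set G : E → ℝ := fun w => exp (h / 2 * ‖m‖ ^ 2 - ⟪m, w⟫) with hG
  set r := channelDensity ν h with hr
  have hrpos : ∀ w, 0 < r w := fun w => channelDensity_pos (integrable_cmDensity_of_bounded hR hh w)
  -- the linear term
  have hlin : Integrable (fun w => r w • ⟪m, w⟫) (scaledGaussian E h) ∧
      ∫ w, r w • ⟪m, w⟫ ∂(scaledGaussian E h) = h * ‖m‖ ^ 2 := by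
    have i1 : Integrable (fun z : E × E => ⟪m, z.2⟫) (ν.prod (scaledGaussian E h)) :=
      Integrable.comp_snd (f := fun w => ⟪m, w⟫)
        ((integrable_id_scaledGaussian h).const_inner m) ν
    have i2 : Integrable (fun z : E × E => h * ⟪m, z.1⟫) (ν.prod (scaledGaussian E h)) :=
      Integrable.comp_fst (f := fun w => h * ⟪m, w⟫)
        ((hid.const_inner m).const_mul h) (scaledGaussian E h)
    have e : ∀ z : E × E, ⟪m, z.2 + h • z.1⟫ = ⟪m, z.2⟫ + h * ⟪m, z.1⟫ := fun z => by
      rw [inner_add_right, real_inner_smul_right]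
    obtain ⟨h1, h2⟩ := integral_channelDensity_smul (μ := ν) hh (φ := fun w => ⟪m, w⟫)
      (Continuous.stronglyMeasurable (by fun_prop)) (by simp_rw [e]; exact i1.add i2)
    refine ⟨h1, h2.trans ?_⟩
    simp_rw [e]
    rw [integral_add i1 i2, integral_fun_snd (f := fun w => ⟪m, w⟫),
      integral_fun_fst (f := fun x => h * ⟪m, x⟫), integral_const_mul,
      integral_inner (integrable_id_scaledGaussian h),
      integral_inner hid]
    rw [integral_id_scaledGaussian]
    simp [← hm]
  -- the quadratic term
  set K : (E × E) × E → ℝ := fun z => cmDensity h z.1.1 z.2 * cmDensity h z.1.2 z.2 * G z.2 with hK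
  have hKm : Measurable K := by simp only [hK, hG]; fun_prop
  have hKi : Integrable K ((ν.prod ν).prod (scaledGaussian E h)) := by
    refine Integrable.mono'
      (g := fun z => exp (h / 2 * R ^ 2) * exp ((3 * R) * ‖z.2‖))
      (((integrable_exp_mul_norm_scaledGaussian (E := E) h (3 * R)).comp_snd
        (ν.prod ν)).const_mul _) hKm.aestronglyMeasurable ?_
    have hb : ∀ᵐ z ∂((ν.prod ν).prod (scaledGaussian E h)), ‖z.1.1‖ ≤ R ∧ ‖z.1.2‖ ≤ R := by
      have a1 : ∀ᵐ z ∂(ν.prod ν), ‖z.1‖ ≤ R :=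
        Measure.quasiMeasurePreserving_fst.ae hR
      have a2 : ∀ᵐ z ∂(ν.prod ν), ‖z.2‖ ≤ R :=
        Measure.quasiMeasurePreserving_snd.ae hR
      exact Measure.quasiMeasurePreserving_fst.ae (a1.and a2)
    filter_upwards [hb] with z hz
    have hG1 : G z.2 ≤ exp (h / 2 * R ^ 2 + R * ‖z.2‖) := by
      refine exp_le_exp.2 ?_
      have h1 : -⟪m, z.2⟫ ≤ ‖m‖ * ‖z.2‖ := by
        have := abs_real_inner_le_norm m z.2
        linarith [neg_abs_le ⟪m, z.2⟫]
      have h2 : ‖m‖ * ‖z.2‖ ≤ R * ‖z.2‖ := by gcongr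
      have h3 : h / 2 * ‖m‖ ^ 2 ≤ h / 2 * R ^ 2 := by gcongr
      linarith
    rw [norm_of_nonneg (by simp only [hK, hG, cmDensity]; positivity)]
    calc K z ≤ exp (R * ‖z.2‖) * exp (R * ‖z.2‖) * exp (h / 2 * R ^ 2 + R * ‖z.2‖) := by
          have c1 := cmDensity_le (w := z.2) hh hz.1
          have c2 := cmDensity_le (w := z.2) hh hz.2
          have p1 := (cmDensity_pos h z.1.1 z.2).le
          have p2 := (cmDensity_pos h z.1.2 z.2).le
          have p3 : 0 ≤ G z.2 := (exp_pos _).le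
          simp only [hK]
          gcongr
      _ = _ := by
          rw [← exp_add, ← exp_add, ← exp_add]
          ring_nf
  have hr2 : ∀ w, r w * (r w * G w) = ∫ z, K (z, w) ∂(ν.prod ν) := by
    intro w
    simp only [hK]
    rw [integral_mul_const, integral_prod_mul (fun x => cmDensity h x w) fun x => cmDensity h x w]
    simp only [hr, channelDensity]
    ring
  have hr2i : Integrable (fun w => r w * (r w * G w)) (scaledGaussian E h) := by
    simp_rw [hr2]
    exact hKi.integral_prod_right
  have hin : ∀ z : E × E, ∫ w, K (z, w) ∂(scaledGaussian E h) = exp (h * ⟪z.1 - m, z.2 - m⟫) := by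
    intro z
    have e : ∀ w, K (z, w) = exp (h * ⟪z.1 - m, z.2 - m⟫) * cmDensity h (z.1 + z.2 - m) w := by
      intro w
      simp only [hK, hG, cmDensity, ← exp_add]
      congr 1
      have e1 : ‖z.1 + z.2 - m‖ ^ 2 = ‖z.1‖ ^ 2 + ‖z.2‖ ^ 2 + ‖m‖ ^ 2 + 2 * ⟪z.1, z.2⟫
          - 2 * ⟪z.1, m⟫ - 2 * ⟪z.2, m⟫ := by
        rw [norm_sub_sq_real, norm_add_sq_real, inner_add_left]; ring
      rw [e1]
      simp only [inner_sub_left, inner_sub_right, inner_add_left, real_inner_self_eq_norm_sq,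
        real_inner_comm z.2 m]
      ring
    simp_rw [e]
    rw [integral_const_mul, integral_cmDensity hh, mul_one]
  have hcen : Integrable (fun x => x - m) ν := hid.sub (integrable_const m)
  have hinner : Integrable (fun z : E × E => ⟪z.1 - m, z.2 - m⟫) (ν.prod ν) := by
    refine (hcen.norm.mul_prod hcen.norm).mono'
      (Continuous.aestronglyMeasurable (by fun_prop)) (ae_of_all _ fun z => ?_)
    exact norm_inner_le_norm _ _
  have hquad : ∫ w, r w * (r w * G w) ∂(scaledGaussian E h) ≤ 1 + (h * (4 * R ^ 2)) ^ 2 := by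
    simp_rw [hr2]
    rw [← integral_prod_symm _ hKi, integral_prod _ hKi]
    simp_rw [hin]
    have hle : ∫ z, exp (h * ⟪z.1 - m, z.2 - m⟫) ∂(ν.prod ν) ≤
        ∫ z, (h * ⟪z.1 - m, z.2 - m⟫ + (1 + (h * (4 * R ^ 2)) ^ 2)) ∂(ν.prod ν) := by
      refine integral_mono_ae ?_ ((hinner.const_mul h).add (integrable_const _)) ?_
      · simp_rw [← hin]; exact hKi.integral_prod_left
      · have a1 : ∀ᵐ z ∂(ν.prod ν), ‖z.1‖ ≤ R := Measure.quasiMeasurePreserving_fst.ae hR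
        have a2 : ∀ᵐ z ∂(ν.prod ν), ‖z.2‖ ≤ R := Measure.quasiMeasurePreserving_snd.ae hR
        filter_upwards [a1, a2] with z h1 h2
        set u := h * ⟪z.1 - m, z.2 - m⟫ with hu
        have hu1 : |u| ≤ h * (4 * R ^ 2) := by
          rw [hu, abs_mul, abs_of_nonneg hh]
          have b1 : ‖z.1 - m‖ ≤ 2 * R := (norm_sub_le _ _).trans (by linarith)
          have b2 : ‖z.2 - m‖ ≤ 2 * R := (norm_sub_le _ _).trans (by linarith)
          have b3 : |⟪z.1 - m, z.2 - m⟫| ≤ (2 * R) * (2 * R) :=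
            (abs_real_inner_le_norm _ _).trans (by gcongr)
          gcongr
          linarith
        have h3 := (abs_le.1 (abs_exp_sub_one_sub_id_le (hu1.trans hhR))).2
        have h4 : u ^ 2 ≤ (h * (4 * R ^ 2)) ^ 2 := sq_le_sq' (abs_le.1 hu1).1 (abs_le.1 hu1).2
        linarith
    refine hle.trans (le_of_eq ?_)
    rw [integral_add (hinner.const_mul h) (integrable_const _), integral_const_mul,
      integral_prod _ hinner]
    have : ∀ x : E, ∫ y, ⟪x - m, y - m⟫ ∂ν = 0 := by
      intro x
      rw [integral_inner hcen, integral_sub hid (integrable_const m)]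
      simp [← hm]
    simp [this]
  have hrint := integrable_channelDensity (μ := ν) hh
  -- `log a ≤ a - 1` at `a = r w * G w`, the density relative to the Gaussian with mean `h • m`
  have hpt : ∀ w, r w * log (r w) ≤
      r w * (r w * G w) + (r w • ⟪m, w⟫ - r w * (1 + h / 2 * ‖m‖ ^ 2)) := by
    intro w
    have h1 := log_le_sub_one_of_pos (mul_pos (hrpos w) (exp_pos (h / 2 * ‖m‖ ^ 2 - ⟪m, w⟫)))
    rw [log_mul (hrpos w).ne' (exp_pos _).ne', log_exp] at h1
    have h2 := mul_le_mul_of_nonneg_left h1 (hrpos w).le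
    simp only [hG, smul_eq_mul]
    nlinarith
  have hr1 : ∫ w, r w ∂(scaledGaussian E h) = 1 := by
    rw [hr, integral_channelDensity hh]; simp
  have hfin := integral_mono (integrable_channelDensity_mul_log hh hsq (by simp))
    (hr2i.add (hlin.1.sub (hrint.mul_const (1 + h / 2 * ‖m‖ ^ 2)))) hpt
  have hsum : ∫ w, (r w * (r w * G w) + (r w • ⟪m, w⟫ - r w * (1 + h / 2 * ‖m‖ ^ 2)))
      ∂(scaledGaussian E h) = ∫ w, r w * (r w * G w) ∂(scaledGaussian E h) +
        (h * ‖m‖ ^ 2 - (1 + h / 2 * ‖m‖ ^ 2)) := by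
    have h1 : Integrable (fun w => r w * (1 + h / 2 * ‖m‖ ^ 2)) (scaledGaussian E h) :=
      hrint.mul_const _
    have h2 : Integrable (fun w => r w • ⟪m, w⟫ - r w * (1 + h / 2 * ‖m‖ ^ 2))
      (scaledGaussian E h) := hlin.1.sub h1
    rw [integral_add hr2i h2, integral_sub hlin.1 h1, hlin.2, integral_mul_const, hr1, one_mul]
  have hfin' : channelEntropy ν h ≤ ∫ w, (r w * (r w * G w) +
      (r w • ⟪m, w⟫ - r w * (1 + h / 2 * ‖m‖ ^ 2))) ∂(scaledGaussian E h) := hfin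
  rw [hsum] at hfin'
  linarith

/-- The conditional law of `X ∼ μ` given `s X + √s N = y`. -/
noncomputable def posterior (μ : Measure E) (s : ℝ) (y : E) : Measure E :=
  μ.tilted (fun x => ⟪x, y⟫ - s / 2 * ‖x‖ ^ 2)

lemma isProbabilityMeasure_posterior [NeZero μ] (hR : ∀ᵐ x ∂μ, ‖x‖ ≤ R) (hs : 0 ≤ s) (y : E) :
    IsProbabilityMeasure (posterior μ s y) :=
  isProbabilityMeasure_tilted (integrable_cmDensity_of_bounded hR hs y)

lemma integral_posterior {F : Type*} [NormedAddCommGroup F] [NormedSpace ℝ F] (y : E) (g : E → F) :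
    ∫ x, g x ∂(posterior μ s y) =
      (channelDensity μ s y)⁻¹ • ∫ x, cmDensity s x y • g x ∂μ := by
  rw [posterior, integral_tilted, ← integral_smul]
  refine integral_congr_ae (ae_of_all _ fun x => ?_)
  simp only [smul_smul, channelDensity, cmDensity]
  rw [div_eq_inv_mul]

lemma channelDensity_posterior (y w : E) :
    channelDensity (posterior μ s y) h w =
      (channelDensity μ s y)⁻¹ * channelDensity μ (s + h) (y + w) := by
  rw [channelDensity, integral_posterior]
  simp only [smul_eq_mul, ← cmDensity_add, channelDensity]

lemma channelMoment_posterior (y w : E) :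
    channelMoment (posterior μ s y) h w =
      (channelDensity μ s y)⁻¹ • channelMoment μ (s + h) (y + w) := by
  rw [channelMoment, integral_posterior]
  simp only [smul_smul, ← cmDensity_add, channelMoment]

/-- Integration against the Gaussian at time `s + h` by conditioning on the value at time `s`. -/
lemma integral_scaledGaussian_add (hs : 0 ≤ s) (hh : 0 ≤ h) {φ : E → ℝ}
    (hφ : Integrable φ (scaledGaussian E (s + h))) :
    Integrable (fun y => ∫ w, φ (y + w) ∂(scaledGaussian E h)) (scaledGaussian E s) ∧
      ∫ y, φ y ∂(scaledGaussian E (s + h)) =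
        ∫ y, ∫ w, φ (y + w) ∂(scaledGaussian E h) ∂(scaledGaussian E s) := by
  rw [← scaledGaussian_conv hs hh] at hφ ⊢
  have h1 := (integrable_map_measure hφ.aestronglyMeasurable (by fun_prop)).1 hφ
  rw [integral_map (by fun_prop) hφ.aestronglyMeasurable]
  exact ⟨h1.integral_prod_left, integral_prod _ h1⟩

/-- The second moment of the posterior mean increases with time. -/
lemma posteriorEnergy_mono_of_bounded [NeZero μ] (hR : ∀ᵐ x ∂μ, ‖x‖ ≤ R) (hs : 0 ≤ s)
    (hh : 0 ≤ h) : posteriorEnergy μ s ≤ posteriorEnergy μ (s + h) := by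
  have hsq := integrable_sq_of_bounded hR
  obtain ⟨h1, h2⟩ := integral_scaledGaussian_add hs hh
    (integrable_posteriorEnergy (μ := μ) (add_nonneg hs hh) hsq)
  rw [posteriorEnergy, posteriorEnergy, h2]
  refine integral_mono (integrable_posteriorEnergy hs hsq) h1 fun y => ?_
  have hp : 0 < channelDensity μ s y := channelDensity_pos (integrable_cmDensity_of_bounded hR hs y)
  have := isProbabilityMeasure_posterior hR hs y
  have hR' : ∀ᵐ x ∂(posterior μ s y), ‖x‖ ≤ R := (tilted_absolutelyContinuous _ _).ae_le hR
  have hsq' := integrable_sq_of_bounded hR'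
  have key := norm_sq_integral_div_le (ae_channelDensity_pos (μ := posterior μ s y) hh)
    (integrable_channelDensity hh) (integrable_channelMoment hh hsq')
    (integrable_posteriorEnergy hh hsq')
  have hmean : ∫ w, channelMoment (posterior μ s y) h w ∂(scaledGaussian E h) =
      (channelDensity μ s y)⁻¹ • channelMoment μ s y := by
    refine (integral_integral_cmDensity_smul hh (g := fun x => x) stronglyMeasurable_id
      (integrable_id_of_sq hsq')).trans ?_
    rw [integral_posterior]
    rfl
  rw [hmean, integral_channelDensity hh] at key
  have e : ∀ w, ‖channelMoment (posterior μ s y) h w‖ ^ 2 / channelDensity (posterior μ s y) h w =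
      (channelDensity μ s y)⁻¹ *
        (‖channelMoment μ (s + h) (y + w)‖ ^ 2 / channelDensity μ (s + h) (y + w)) := by
    intro w
    rw [channelMoment_posterior, channelDensity_posterior, norm_smul, mul_pow, norm_eq_abs, sq_abs]
    have : channelDensity μ (s + h) (y + w) ≠ 0 :=
      (channelDensity_pos (integrable_cmDensity_of_bounded hR (add_nonneg hs hh) _)).ne'
    field_simp
  simp_rw [e] at key
  rw [integral_const_mul, norm_smul, mul_pow, norm_eq_abs, sq_abs, probReal_univ, div_one] at key
  have := mul_le_mul_of_nonneg_left key hp.le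
  rw [mul_inv_cancel_left₀ hp.ne'] at this
  refine le_trans (le_of_eq ?_) this
  field_simp

lemma channelEntropy_add_le_of_bounded [NeZero μ] (hμ1 : μ Set.univ ≤ 1) (hR : ∀ᵐ x ∂μ, ‖x‖ ≤ R)
    (hs : 0 ≤ s) (hh : 0 ≤ h) (hhR : h * (4 * R ^ 2) ≤ 1) :
    channelEntropy μ (s + h) ≤
      channelEntropy μ s + h / 2 * posteriorEnergy μ s + (4 * R ^ 2) ^ 2 * h ^ 2 := by
  have hsq := integrable_sq_of_bounded hR
  obtain ⟨h1, h2⟩ := integral_scaledGaussian_add hs hh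
    (integrable_channelDensity_mul_log (μ := μ) (add_nonneg hs hh) hsq hμ1)
  have i1 := integrable_channelDensity_mul_log hs hsq hμ1
  have i2 := (integrable_posteriorEnergy hs hsq).const_mul (h / 2)
  have i3 := (integrable_channelDensity (μ := μ) hs).mul_const ((h * (4 * R ^ 2)) ^ 2)
  have key : channelEntropy μ (s + h) ≤ ∫ y, (channelDensity μ s y * log (channelDensity μ s y) +
      h / 2 * (‖channelMoment μ s y‖ ^ 2 / channelDensity μ s y) +
      channelDensity μ s y * (h * (4 * R ^ 2)) ^ 2) ∂(scaledGaussian E s) := by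
    rw [channelEntropy, h2]
    refine integral_mono h1 ((i1.add i2).add i3) fun y => ?_
    have hp : 0 < channelDensity μ s y :=
      channelDensity_pos (integrable_cmDensity_of_bounded hR hs y)
    have := isProbabilityMeasure_posterior hR hs y
    have hR' : ∀ᵐ x ∂(posterior μ s y), ‖x‖ ≤ R := (tilted_absolutelyContinuous _ _).ae_le hR
    have hsq' := integrable_sq_of_bounded hR'
    have e : ∀ w, channelDensity μ (s + h) (y + w) * log (channelDensity μ (s + h) (y + w)) =
        channelDensity μ s y * (channelDensity (posterior μ s y) h w *
          log (channelDensity (posterior μ s y) h w)) +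
        channelDensity μ s y * log (channelDensity μ s y) *
          channelDensity (posterior μ s y) h w := by
      intro w
      have h3 : channelDensity μ (s + h) (y + w) ≠ 0 :=
        (channelDensity_pos (integrable_cmDensity_of_bounded hR (add_nonneg hs hh) _)).ne'
      rw [channelDensity_posterior, log_mul (inv_ne_zero hp.ne') h3, log_inv]
      field_simp
      ring
    have hstep := channelEntropy_le_of_bounded hR' hh hhR
    rw [integral_posterior] at hstep
    simp only
    simp_rw [e]
    rw [integral_add ((integrable_channelDensity_mul_log hh hsq' (by simp)).const_mul _)
      ((integrable_channelDensity hh).const_mul _), integral_const_mul, integral_const_mul,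
      integral_channelDensity hh, probReal_univ, mul_one]
    change channelDensity μ s y * channelEntropy (posterior μ s y) h + _ ≤ _
    have hmul := mul_le_mul_of_nonneg_left hstep hp.le
    have e2 : channelDensity μ s y * (h / 2 *
        ‖(channelDensity μ s y)⁻¹ • ∫ x, cmDensity s x y • x ∂μ‖ ^ 2 + (h * (4 * R ^ 2)) ^ 2) =
        h / 2 * (‖channelMoment μ s y‖ ^ 2 / channelDensity μ s y) +
          channelDensity μ s y * (h * (4 * R ^ 2)) ^ 2 := by
      rw [norm_smul, mul_pow, norm_eq_abs, sq_abs, ← channelMoment]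
      field_simp
    rw [e2] at hmul
    linarith
  have i12 : Integrable (fun y => channelDensity μ s y * log (channelDensity μ s y) +
      h / 2 * (‖channelMoment μ s y‖ ^ 2 / channelDensity μ s y)) (scaledGaussian E s) := i1.add i2
  rw [integral_add i12 i3, integral_add i1 i2, integral_const_mul, integral_mul_const,
    integral_channelDensity hs] at key
  have hm1 : μ.real Set.univ ≤ 1 := ENNReal.toReal_le_of_le_ofReal zero_le_one (by simpa using hμ1)
  have := mul_le_mul_of_nonneg_right hm1 (sq_nonneg (h * (4 * R ^ 2)))
  change _ ≤ channelEntropy μ s + h / 2 * posteriorEnergy μ s + _ at key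
  nlinarith

/-- A forward Euler bound with quadratic error integrates, along finer and finer subdivisions, to
the bound by the rate at the final time when the rate is monotone. -/
lemma le_of_forward_step {G a : ℝ → ℝ} {K C : ℝ}
    (hstep : ∀ s h, 0 ≤ s → 0 ≤ h → h * K ≤ 1 → G (s + h) ≤ G s + h / 2 * a s + C * h ^ 2)
    (ha : ∀ s h, 0 ≤ s → 0 ≤ h → a s ≤ a (s + h)) (hs : 0 ≤ s) (hh : 0 ≤ h) :
    G (s + h) ≤ G s + h / 2 * a (s + h) := by
  have hM : ∀ᶠ M : ℕ in Filter.atTop,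
      G (s + h) ≤ G s + h / 2 * a (s + h) + C * h ^ 2 / M := by
    filter_upwards [Filter.eventually_ge_atTop (max 1 ⌈h * K⌉₊)] with M hM
    have hM1 : 1 ≤ M := (le_max_left _ _).trans hM
    have hM0 : (0 : ℝ) < M := by exact_mod_cast hM1
    have hMK : h / M * K ≤ 1 := by
      have : h * K ≤ M := (Nat.le_ceil _).trans (by exact_mod_cast (le_max_right _ _).trans hM)
      rw [div_mul_eq_mul_div, div_le_one hM0]
      exact this
    have hj : ∀ j : ℕ, j ≤ M → G (s + j * (h / M)) ≤
        G s + j * (h / M / 2 * a (s + h) + C * (h / M) ^ 2) := by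
      intro j
      induction j with
      | zero => intro; simp
      | succ j ih =>
        intro hj
        have h0 : 0 ≤ h / M := by positivity
        have h1 := hstep (s + j * (h / M)) (h / M) (by positivity) h0 hMK
        have h2 := ha (s + j * (h / M)) (h - j * (h / M)) (by positivity) (by
          have : (j : ℝ) ≤ M := by exact_mod_cast (Nat.le_succ j).trans hj
          have := mul_le_mul_of_nonneg_right this h0
          rw [mul_div_cancel₀ _ hM0.ne'] at this
          linarith)
        rw [show s + j * (h / M) + (h - j * (h / M)) = s + h by ring] at h2
        have h3 := ih (by omega)
        have h4 : h / M / 2 * a (s + j * (h / M)) ≤ h / M / 2 * a (s + h) := by gcongr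
        push_cast
        rw [show s + ((j : ℝ) + 1) * (h / M) = s + j * (h / M) + h / M by ring]
        linarith
    have := hj M le_rfl
    rw [mul_div_cancel₀ _ hM0.ne'] at this
    refine this.trans (le_of_eq ?_)
    field_simp
    ring
  have hlim : Filter.Tendsto (fun M : ℕ => G s + h / 2 * a (s + h) + C * h ^ 2 / M) Filter.atTop
      (nhds (G s + h / 2 * a (s + h) + 0)) :=
    tendsto_const_nhds.add (tendsto_const_div_atTop_nhds_zero_nat _)
  rw [add_zero] at hlim
  exact ge_of_tendsto hlim hM

/-- The entropy grows at most at half the rate given by the posterior energy at the final time. -/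
lemma channelEntropy_add_le [NeZero μ] (hμ1 : μ Set.univ ≤ 1) (hR : ∀ᵐ x ∂μ, ‖x‖ ≤ R)
    (hs : 0 ≤ s) (hh : 0 ≤ h) :
    channelEntropy μ (s + h) ≤ channelEntropy μ s + h / 2 * posteriorEnergy μ (s + h) :=
  le_of_forward_step
    (fun _ _ hs hh hK => channelEntropy_add_le_of_bounded hμ1 hR hs hh hK)
    (fun _ _ hs hh => posteriorEnergy_mono_of_bounded hR hs hh) hs hh

end Bounded

/-! ### Removal of the boundedness assumption by truncation -/

section Truncation

variable {μ : Measure E} [IsFiniteMeasure μ] {t : ℝ}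

/-- The restriction of `μ` to the closed ball of radius `R` around the origin. -/
noncomputable def truncation (μ : Measure E) (R : ℕ) : Measure E :=
  μ.restrict (Metric.closedBall 0 R)

instance (R : ℕ) : IsFiniteMeasure (truncation μ R) := by
  unfold truncation; infer_instance

lemma truncation_le (R : ℕ) : truncation μ R ≤ μ := Measure.restrict_le_self

lemma ae_norm_le_truncation (R : ℕ) : ∀ᵐ x ∂(truncation μ R), ‖x‖ ≤ R := by
  filter_upwards [ae_restrict_mem Metric.isClosed_closedBall.measurableSet] with x hx
  simpa using hx

lemma tendsto_integral_truncation {F : Type*} [NormedAddCommGroup F] [NormedSpace ℝ F] {g : E → F}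
    (hg : Integrable g μ) :
    Filter.Tendsto (fun R : ℕ => ∫ x, g x ∂(truncation μ R)) Filter.atTop
      (nhds (∫ x, g x ∂μ)) := by
  have h := tendsto_setIntegral_of_monotone (μ := μ) (f := g)
    (s := fun R : ℕ => Metric.closedBall (0 : E) R)
    (fun R => Metric.isClosed_closedBall.measurableSet)
    (fun a b hab => Metric.closedBall_subset_closedBall (by exact_mod_cast hab))
    (by rw [Metric.iUnion_closedBall_nat]; exact hg.integrableOn)
  rwa [Metric.iUnion_closedBall_nat, setIntegral_univ] at h

lemma eventually_neZero_truncation [NeZero μ] :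
    ∀ᶠ R : ℕ in Filter.atTop, NeZero (truncation μ R) := by
  have h := tendsto_integral_truncation (μ := μ) (integrable_const (1 : ℝ))
  have hpos : 0 < ∫ _, (1 : ℝ) ∂μ := by
    simp only [integral_const, smul_eq_mul, mul_one]
    exact ENNReal.toReal_pos (Measure.measure_univ_pos.2 (NeZero.ne μ)).ne' (measure_ne_top _ _)
  filter_upwards [h.eventually (lt_mem_nhds hpos)] with R hR
  refine ⟨fun h0 => ?_⟩
  rw [h0] at hR
  simp at hR

lemma tendsto_channelEntropy_truncation [NeZero μ] (ht : 0 ≤ t)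
    (hμ : Integrable (fun x => ‖x‖ ^ 2) μ) (hμ1 : μ Set.univ ≤ 1) :
    Filter.Tendsto (fun R => channelEntropy (truncation μ R) t) Filter.atTop
      (nhds (channelEntropy μ t)) := by
  refine tendsto_integral_of_dominated_convergence _
    (fun R => Measurable.aestronglyMeasurable (by fun_prop))
    (integrable_one_add_integral_abs ht hμ) (fun R => ?_) ?_
  · filter_upwards [ae_abs_channelDensity_mul_log_le ht hμ] with w hw
    exact hw _ (truncation_le R) ((truncation_le R _).trans hμ1)
  · filter_upwards [ae_integrable_cmDensity μ ht] with w hw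
    have h1 : Filter.Tendsto (fun R => channelDensity (truncation μ R) t w) Filter.atTop
        (nhds (channelDensity μ t w)) := tendsto_integral_truncation hw
    exact h1.mul (h1.log (channelDensity_pos hw).ne')

lemma tendsto_posteriorEnergy_truncation [NeZero μ] (ht : 0 ≤ t)
    (hμ : Integrable (fun x => ‖x‖ ^ 2) μ) :
    Filter.Tendsto (fun R => posteriorEnergy (truncation μ R) t) Filter.atTop
      (nhds (posteriorEnergy μ t)) := by
  refine tendsto_integral_of_dominated_convergence _
    (fun R => Measurable.aestronglyMeasurable (by fun_prop))
    (integrable_integral_cmDensity_mul_sq ht hμ) (fun R => ?_) ?_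
  · filter_upwards [ae_norm_channelMoment_sq_div_le ht (hμ.mono_measure (truncation_le R)),
      ae_integrable_cmDensity_smul ht (g := fun x => ‖x‖ ^ 2) (by fun_prop) hμ] with w hw h2
    rw [norm_of_nonneg (div_nonneg (by positivity) (channelDensity_nonneg _ _ _))]
    exact hw.trans (integral_mono_measure (truncation_le R)
      (ae_of_all _ fun x => mul_nonneg (cmDensity_pos _ _ _).le (by positivity)) h2)
  · filter_upwards [ae_integrable_cmDensity μ ht,
      ae_integrable_cmDensity_smul ht (g := fun x => x) stronglyMeasurable_id
        (integrable_id_of_sq hμ)] with w hw h2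
    have h1 : Filter.Tendsto (fun R => channelDensity (truncation μ R) t w) Filter.atTop
        (nhds (channelDensity μ t w)) := tendsto_integral_truncation hw
    have h3 : Filter.Tendsto (fun R => channelMoment (truncation μ R) t w) Filter.atTop
        (nhds (channelMoment μ t w)) := tendsto_integral_truncation h2
    exact (h3.norm.pow 2).div h1 (channelDensity_pos hw).ne'

/-- A form of the Gaussian logarithmic Sobolev inequality for the channel between the times `s`
and `s + h`. -/
lemma channelEntropy_le_add [NeZero μ] (hμ : Integrable (fun x => ‖x‖ ^ 2) μ)
    (hμ1 : μ Set.univ ≤ 1) {s h : ℝ} (hs : 0 ≤ s) (hh : 0 ≤ h) :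
    channelEntropy μ (s + h) ≤ channelEntropy μ s + h / 2 * posteriorEnergy μ (s + h) := by
  refine le_of_tendsto_of_tendsto
    (tendsto_channelEntropy_truncation (add_nonneg hs hh) hμ hμ1)
    ((tendsto_channelEntropy_truncation hs hμ hμ1).add
      ((tendsto_posteriorEnergy_truncation (add_nonneg hs hh) hμ).const_mul (h / 2))) ?_
  filter_upwards [eventually_neZero_truncation (μ := μ)] with R hR
  exact channelEntropy_add_le ((truncation_le R _).trans hμ1) (ae_norm_le_truncation R) hs hh

lemma posteriorEnergy_mono [NeZero μ] (hμ : Integrable (fun x => ‖x‖ ^ 2) μ) {s h : ℝ}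
    (hs : 0 ≤ s) (hh : 0 ≤ h) : posteriorEnergy μ s ≤ posteriorEnergy μ (s + h) := by
  refine le_of_tendsto_of_tendsto (tendsto_posteriorEnergy_truncation hs hμ)
    (tendsto_posteriorEnergy_truncation (add_nonneg hs hh) hμ) ?_
  filter_upwards [eventually_neZero_truncation (μ := μ)] with R hR
  exact posteriorEnergy_mono_of_bounded (ae_norm_le_truncation R) hs hh

end Truncation

/-! ### The entropy after `n` steps -/

section Steps

variable {μ : Measure E} [IsProbabilityMeasure μ]

lemma scaledGaussian_zero : scaledGaussian E 0 = Measure.dirac 0 := by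
  simp [scaledGaussian, Measure.map_const]

lemma channelEntropy_zero : channelEntropy μ 0 = 0 := by
  simp [channelEntropy, scaledGaussian_zero, channelDensity, cmDensity]

lemma posteriorEnergy_zero : posteriorEnergy μ 0 = ‖∫ x, x ∂μ‖ ^ 2 := by
  simp [posteriorEnergy, scaledGaussian_zero, channelDensity, channelMoment, cmDensity]

/-- The total time `δ 1 + ⋯ + δ k` elapsed after `k` steps. -/
noncomputable def elapsedTime (δ : ℕ → ℝ) (k : ℕ) : ℝ := ∑ j ∈ Finset.range k, δ (j + 1)

lemma elapsedTime_succ (δ : ℕ → ℝ) (k : ℕ) : elapsedTime δ (k + 1) = elapsedTime δ k + δ (k + 1) :=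
  Finset.sum_range_succ _ _

lemma elapsedTime_nonneg {δ : ℕ → ℝ} {n : ℕ} (hδ : ∀ k ∈ Finset.Icc 1 n, 0 < δ k) {k : ℕ}
    (hk : k ≤ n) : 0 ≤ elapsedTime δ k :=
  Finset.sum_nonneg fun j hj => (hδ (j + 1) (by simp at hj ⊢; omega)).le

/-- Replacing the posterior energy at the end of each step by that at its beginning costs at most
the largest step times the total increase of the posterior energy. -/
lemma channelEntropy_elapsedTime_le (hμ : Integrable (fun x => ‖x‖ ^ 2) μ) {δ : ℕ → ℝ} {n : ℕ}
    (hδ : ∀ k ∈ Finset.Icc 1 n, 0 < δ k) {M : ℝ} (hM0 : 0 ≤ M)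
    (hM : ∀ k ∈ Finset.Icc 1 n, δ k ≤ M) :
    channelEntropy μ (elapsedTime δ n) ≤
      M / 2 * (∫ x, ‖x‖ ^ 2 ∂μ - ‖∫ x, x ∂μ‖ ^ 2) +
        ∑ k ∈ Finset.range n, δ (k + 1) / 2 * posteriorEnergy μ (elapsedTime δ k) := by
  have key : ∀ k ≤ n, channelEntropy μ (elapsedTime δ k) ≤
      M / 2 * (posteriorEnergy μ (elapsedTime δ k) - posteriorEnergy μ 0) +
        ∑ j ∈ Finset.range k, δ (j + 1) / 2 * posteriorEnergy μ (elapsedTime δ j) := by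
    intro k
    induction k with
    | zero => intro _; simp [elapsedTime, channelEntropy_zero]
    | succ k ih =>
      intro hk
      have hmem : k + 1 ∈ Finset.Icc 1 n := by simp; omega
      have h0 := elapsedTime_nonneg hδ (k := k) (by omega)
      have h1 := channelEntropy_le_add hμ (by simp) h0 (hδ _ hmem).le
      have h2 := posteriorEnergy_mono hμ h0 (hδ _ hmem).le
      have h3 := hM _ hmem
      rw [Finset.sum_range_succ, elapsedTime_succ]
      have h4 := ih (by omega)
      nlinarith
  have h1 := key n le_rfl
  have h2 := posteriorEnergy_le (μ := μ) (elapsedTime_nonneg hδ le_rfl) hμ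
  rw [posteriorEnergy_zero] at h1
  refine h1.trans ?_
  gcongr

end Steps

/-! ### Relative entropy of measures with densities -/

lemma klDiv_withDensity_eq {α : Type*} [MeasurableSpace α] {ν : Measure α} [SFinite ν]
    {a L : α → ℝ} (ha : Measurable a) (hL : Measurable L) (hpos : ∀ᵐ z ∂ν, 0 < a z)
    [IsProbabilityMeasure (ν.withDensity fun z => ENNReal.ofReal (a z))]
    [IsProbabilityMeasure (ν.withDensity fun z => ENNReal.ofReal (exp (L z)))]
    (hi : Integrable (fun z => log (a z) - L z) (ν.withDensity fun z => ENNReal.ofReal (a z))) :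
    InformationTheory.klDiv (ν.withDensity fun z => ENNReal.ofReal (a z))
        (ν.withDensity fun z => ENNReal.ofReal (exp (L z))) =
      ENNReal.ofReal
        (∫ z, (log (a z) - L z) ∂(ν.withDensity fun z => ENNReal.ofReal (a z))) := by
  set μY := ν.withDensity fun z => ENNReal.ofReal (a z) with hY
  set μZ := ν.withDensity fun z => ENNReal.ofReal (exp (L z)) with hZ
  have hρm : Measurable fun z => ENNReal.ofReal (a z * exp (-L z)) := by fun_prop
  have hYZ : μY = μZ.withDensity fun z => ENNReal.ofReal (a z * exp (-L z)) := by
    rw [hZ, ← withDensity_mul _ (by fun_prop) hρm, hY]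
    congr 1
    ext z
    rw [Pi.mul_apply, ← ENNReal.ofReal_mul (exp_pos _).le, mul_left_comm, ← exp_add,
      add_neg_cancel, exp_zero, mul_one]
  have hac : μY ≪ μZ := hYZ ▸ withDensity_absolutelyContinuous _ _
  have hrn : μY.rnDeriv μZ =ᵐ[μZ] fun z => ENNReal.ofReal (a z * exp (-L z)) := by
    rw [hYZ]
    exact Measure.rnDeriv_withDensity _ hρm
  have hllr : llr μY μZ =ᵐ[μY] fun z => log (a z) - L z := by
    filter_upwards [hac.ae_le hrn, (withDensity_absolutelyContinuous ν _).ae_le hpos] with z h1 h2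
    rw [llr, h1, ENNReal.toReal_ofReal (by positivity), log_mul h2.ne' (exp_pos _).ne', log_exp,
      sub_eq_add_neg]
  rw [InformationTheory.klDiv_of_ac_of_integrable hac (hi.congr hllr.symm),
    integral_congr_ae hllr, probReal_univ, probReal_univ, add_sub_cancel_right]

/-! ### Densities of the path laws with respect to the driftless walk -/

lemma lintegral_indepFun {Ω α β : Type*} [MeasurableSpace Ω] [MeasurableSpace α]
    [MeasurableSpace β] {P : Measure Ω} [IsProbabilityMeasure P] {U : Ω → α} {V : Ω → β}
    (hU : Measurable U) (hV : Measurable V) (h : IndepFun U V P) {φ : α × β → ℝ≥0∞}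
    (hφ : Measurable φ) :
    ∫⁻ ω, φ (U ω, V ω) ∂P = ∫⁻ ω, ∫⁻ v, φ (U ω, v) ∂(P.map V) ∂P := by
  have := Measure.isProbabilityMeasure_map (μ := P) hV.aemeasurable
  have := Measure.isProbabilityMeasure_map (μ := P) hU.aemeasurable
  rw [← lintegral_map (f := φ) (g := fun ω => (U ω, V ω)) hφ (by fun_prop),
    (indepFun_iff_map_prod_eq_prod_map_map hU.aemeasurable hV.aemeasurable).1 h,
    lintegral_prod _ hφ.aemeasurable, lintegral_map hφ.lintegral_prod_right' hU]

/-- The steps `1, …, n` of `N` are independent standard Gaussian vectors; independence is expressed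
sequentially, each step being independent of the earlier ones. -/
structure IsGaussianNoise {Ω : Type*} [MeasurableSpace Ω] (P : Measure Ω) (N : ℕ → Ω → E)
    (n : ℕ) : Prop where
  measurable : ∀ k < n, Measurable (N (k + 1))
  map_eq : ∀ k < n, P.map (N (k + 1)) = stdGaussian E
  indepFun : ∀ k < n, IndepFun (fun ω (j : Fin k) => N (j + 1) ω) (N (k + 1)) P

lemma isGaussianNoise_of_iIndepFun {Ω : Type*} [MeasurableSpace Ω] {P : Measure Ω}
    {N : ℕ → Ω → E} {n : ℕ} (hN : ∀ k ∈ Finset.Icc 1 n, Measurable (N k))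
    (hlaw : ∀ k ∈ Finset.Icc 1 n, HasLaw (N k) (stdGaussian E) P)
    (hind : iIndepFun (fun k : Fin n => N (k + 1)) P) : IsGaussianNoise P N n where
  measurable k hk := hN _ (by simp; omega)
  map_eq k hk := (hlaw _ (by simp; omega)).map_eq
  indepFun k hk := by
    have h := hind.indepFun_finset (Finset.univ.filter fun j : Fin n => (j : ℕ) < k)
      {⟨k, hk⟩} (by simp) (fun j => hN _ (by simp))
    have hm1 : Measurable fun (v : (Finset.univ.filter fun j : Fin n => (j : ℕ) < k) → E)
        (j : Fin k) => v ⟨⟨j, j.2.trans hk⟩, by simp⟩ :=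
      measurable_pi_lambda _ fun _ => measurable_pi_apply _
    have hm2 : Measurable fun v : ({⟨k, hk⟩} : Finset (Fin n)) → E => v ⟨⟨k, hk⟩, by simp⟩ :=
      measurable_pi_apply _
    exact h.comp hm1 hm2

/-- The path of `Y` up to time `n`, extended by zero. -/
def pathUpTo {Ω : Type*} (Y : ℕ → Ω → E) (n : ℕ) (ω : Ω) : ℕ → E :=
  fun k => if k ≤ n then Y k ω else 0

lemma pathUpTo_of_le {Ω : Type*} (Y : ℕ → Ω → E) {n k : ℕ} (hk : k ≤ n) (ω : Ω) :
    pathUpTo Y n ω k = Y k ω := if_pos hk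

lemma pathUpTo_succ {Ω : Type*} (Y : ℕ → Ω → E) (n : ℕ) (ω : Ω) :
    pathUpTo Y (n + 1) ω = Function.update (pathUpTo Y n ω) (n + 1) (Y (n + 1) ω) := by
  ext k
  by_cases hk : k = n + 1
  · subst hk; simp [pathUpTo]
  · rw [Function.update_of_ne hk]
    have : k ≤ n + 1 ↔ k ≤ n := by omega
    simp only [pathUpTo, this]

lemma measurable_pathUpTo {Ω : Type*} [MeasurableSpace Ω] {Y : ℕ → Ω → E} {n : ℕ}
    (hY : ∀ k ≤ n, Measurable (Y k)) : Measurable (pathUpTo Y n) := by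
  refine measurable_pi_lambda _ fun k => ?_
  by_cases hk : k ≤ n
  · simpa only [pathUpTo, if_pos hk] using hY k hk
  · simp only [pathUpTo, if_neg hk, measurable_const]

lemma pathLaw_eq_map {Ω : Type*} [MeasurableSpace Ω] (P : Measure Ω) {Y : ℕ → Ω → E} {n : ℕ}
    (hY : ∀ k ≤ n, Measurable (Y k)) :
    pathLaw P Y n = (P.map (pathUpTo Y n)).map (fun z (k : Fin n) => z (k + 1)) := by
  rw [Measure.map_map (by fun_prop) (measurable_pathUpTo hY), pathLaw]
  congr 1
  ext ω k
  simp only [Function.comp_apply]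
  rw [pathUpTo_of_le]
  exact k.2

/-- The logarithm of Girsanov's density at the path `z` for the drifts `f`. -/
noncomputable def logGirsanov (δ : ℕ → ℝ) (f : ℕ → E → E) (n : ℕ) (z : ℕ → E) : ℝ :=
  ∑ k ∈ Finset.range n,
    (⟪f (k + 1) (z k), z (k + 1) - z k⟫ - δ (k + 1) / 2 * ‖f (k + 1) (z k)‖ ^ 2)

lemma measurable_logGirsanov {δ : ℕ → ℝ} {f : ℕ → E → E} {n : ℕ}
    (hf : ∀ k < n, Measurable (f (k + 1))) : Measurable (logGirsanov δ f n) := by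
  refine Finset.measurable_sum _ fun k hk => ?_
  have := hf k (by simpa using hk)
  fun_prop

lemma logGirsanov_congr {δ : ℕ → ℝ} {f : ℕ → E → E} {n : ℕ} {z z' : ℕ → E}
    (h : ∀ k ≤ n, z k = z' k) : logGirsanov δ f n z = logGirsanov δ f n z' := by
  refine Finset.sum_congr rfl fun k hk => ?_
  have hk' : k < n := by simpa using hk
  rw [h k hk'.le, h (k + 1) hk']

section Paths

variable {Ω : Type*} [MeasurableSpace Ω] {P : Measure Ω} {N : ℕ → Ω → E} {δ : ℕ → ℝ} {n : ℕ}

lemma measurable_samplingProcess {f : ℕ → E → E} (hN : ∀ k < n, Measurable (N (k + 1)))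
    (hf : ∀ k < n, Measurable (f (k + 1))) : ∀ k ≤ n, Measurable (samplingProcess δ f N k) := by
  intro k
  induction k with
  | zero => intro _; exact measurable_const
  | succ k ih =>
    intro hk
    have h1 := ih (by omega)
    have h2 := hN k hk
    have h3 := hf k hk
    simp only [samplingProcess]
    fun_prop

lemma IsGaussianNoise.indepFun_pathUpTo (h : IsGaussianNoise P N n) {f : ℕ → E → E}
    (hf : ∀ k < n, Measurable (f (k + 1))) {k : ℕ} (hk : k < n) :
    IndepFun (pathUpTo (samplingProcess δ f N) k) (N (k + 1)) P := by
  have h1 := h.indepFun k hk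
  rw [IndepFun_iff_Indep] at h1 ⊢
  refine indep_of_indep_of_le_left h1 ?_
  rw [← measurable_iff_comap_le]
  -- the path up to time `k` is a measurable function of the first `k` noise variables
  let m : MeasurableSpace Ω :=
    MeasurableSpace.comap (fun ω (j : Fin k) => N (j + 1) ω) inferInstance
  have hm : Measurable[m] (fun ω (j : Fin k) => N (j + 1) ω) := comap_measurable _
  have hN : ∀ j < k, Measurable[m] (N (j + 1)) := fun j hj =>
    (measurable_pi_apply (⟨j, hj⟩ : Fin k)).comp hm
  exact measurable_pathUpTo (measurable_samplingProcess hN fun j hj => hf j (hj.trans hk))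

/-- One step of **Girsanov's formula**. -/
lemma lintegral_stdGaussian_drift {s : ℝ} (hs : 0 ≤ s) (x y : E) {φ : E → ℝ≥0∞}
    (hφ : Measurable φ) :
    ∫⁻ u, φ (y + s • x + √s • u) ∂(stdGaussian E) =
      ∫⁻ u, ENNReal.ofReal (cmDensity s x (√s • u)) * φ (y + √s • u) ∂(stdGaussian E) := by
  rw [← lintegral_scaledGaussian (φ := fun w => φ (y + s • x + w)) (by fun_prop),
    ← lintegral_scaledGaussian (φ := fun w => ENNReal.ofReal (cmDensity s x w) * φ (y + w))
      (by fun_prop),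
    lintegral_mul_cmDensity hs x (φ := fun w => φ (y + w)) (by fun_prop)]
  refine lintegral_congr fun w => ?_
  congr 1
  abel

/-- **Girsanov's formula** for the sampling process. The process and the driftless walk may live on
different probability spaces. -/
lemma lintegral_pathUpTo_samplingProcess [IsProbabilityMeasure P] {Ω' : Type*} [MeasurableSpace Ω']
    {P' : Measure Ω'} [IsProbabilityMeasure P'] {N' : ℕ → Ω' → E} (hδ : ∀ k < n, 0 ≤ δ (k + 1))
    (hP : IsGaussianNoise P N n) (hP' : IsGaussianNoise P' N' n) {f : ℕ → E → E}
    (hf : ∀ k < n, Measurable (f (k + 1))) :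
    ∀ k ≤ n, ∀ φ : (ℕ → E) → ℝ≥0∞, Measurable φ →
      ∫⁻ ω, φ (pathUpTo (samplingProcess δ f N') k ω) ∂P' =
        ∫⁻ ω, ENNReal.ofReal
            (exp (logGirsanov δ f k (pathUpTo (samplingProcess δ (fun _ _ => 0) N) k ω))) *
          φ (pathUpTo (samplingProcess δ (fun _ _ => 0) N) k ω) ∂P := by
  intro k
  induction k with
  | zero =>
    intro _ φ _
    have h1 : ∀ ω, pathUpTo (samplingProcess δ f N') 0 ω = 0 := by
      intro ω; ext k; by_cases hk : k = 0 <;> simp [pathUpTo, hk, samplingProcess]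
    have h2 : ∀ ω, pathUpTo (samplingProcess δ (fun _ _ => (0 : E)) N) 0 ω = 0 := by
      intro ω; ext k; by_cases hk : k = 0 <;> simp [pathUpTo, hk, samplingProcess]
    simp [h1, h2, logGirsanov]
  | succ k ih =>
    intro hk φ hφ
    have hk' : k < n := hk
    set s := δ (k + 1) with hs
    have hfk := hf k hk'
    set B := samplingProcess δ (fun _ _ => (0 : E)) N with hB
    set Z := samplingProcess δ f N' with hZ
    have hBm : ∀ j ≤ k, Measurable (B j) := fun j hj =>
      measurable_samplingProcess hP.measurable (by fun_prop) j (by omega)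
    have hZm : ∀ j ≤ k, Measurable (Z j) := fun j hj =>
      measurable_samplingProcess hP'.measurable hf j (by omega)
    have hupd : ∀ g : (ℕ → E) × E → E, Measurable g →
        Measurable fun z : (ℕ → E) × E => φ (Function.update z.1 (k + 1) (g z)) := by
      refine fun g hg => hφ.comp (measurable_pi_lambda _ fun j => ?_)
      by_cases hj : j = k + 1
      · subst hj; simpa using hg
      · simp only [Function.update_of_ne hj]; fun_prop
    have hLm : Measurable (logGirsanov δ f k) :=
      measurable_logGirsanov fun j hj => hf j (hj.trans hk')
    have eZ : ∀ ω, pathUpTo Z (k + 1) ω = Function.update (pathUpTo Z k ω) (k + 1)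
        (pathUpTo Z k ω k + s • f (k + 1) (pathUpTo Z k ω k) + √s • N' (k + 1) ω) := by
      intro ω
      rw [pathUpTo_succ, pathUpTo_of_le Z le_rfl]
      rfl
    have eB : ∀ ω, pathUpTo B (k + 1) ω = Function.update (pathUpTo B k ω) (k + 1)
        (pathUpTo B k ω k + √s • N (k + 1) ω) := by
      intro ω
      rw [pathUpTo_succ, pathUpTo_of_le B le_rfl]
      simp [hB, hs, samplingProcess]
    have eL : ∀ ω, ENNReal.ofReal (exp (logGirsanov δ f (k + 1) (pathUpTo B (k + 1) ω))) =
        ENNReal.ofReal (exp (logGirsanov δ f k (pathUpTo B k ω))) *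
          ENNReal.ofReal (cmDensity s (f (k + 1) (pathUpTo B k ω k)) (√s • N (k + 1) ω)) := by
      intro ω
      rw [← ENNReal.ofReal_mul (exp_pos _).le, cmDensity, ← exp_add, logGirsanov,
        Finset.sum_range_succ, ← logGirsanov]
      have h1 : logGirsanov δ f k (pathUpTo B (k + 1) ω) = logGirsanov δ f k (pathUpTo B k ω) :=
        logGirsanov_congr fun j hj => by
          rw [pathUpTo_of_le B (by omega), pathUpTo_of_le B hj]
      rw [h1, eB, Function.update_self, Function.update_of_ne (by omega), add_sub_cancel_left]
    have m1 : Measurable fun z : (ℕ → E) × E => φ (Function.update z.1 (k + 1)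
        (z.1 k + s • f (k + 1) (z.1 k) + √s • z.2)) := hupd _ (by fun_prop)
    have m2 : Measurable fun z : (ℕ → E) × E => ENNReal.ofReal (exp (logGirsanov δ f k z.1)) *
        ENNReal.ofReal (cmDensity s (f (k + 1) (z.1 k)) (√s • z.2)) *
          φ (Function.update z.1 (k + 1) (z.1 k + √s • z.2)) :=
      Measurable.mul (by fun_prop) (hupd _ (by fun_prop))
    simp_rw [eL]
    simp_rw [eZ, eB]
    have i1 := lintegral_indepFun (measurable_pathUpTo hZm) (hP'.measurable k hk')
      (hP'.indepFun_pathUpTo hf hk') m1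
    have i2 := lintegral_indepFun (measurable_pathUpTo hBm) (hP.measurable k hk')
      (hP.indepFun_pathUpTo (fun _ _ => measurable_const) hk') m2
    simp only at i1 i2
    rw [i1, i2, hP.map_eq k hk', hP'.map_eq k hk']
    have hψ : Measurable fun z : ℕ → E => ∫⁻ u, φ (Function.update z (k + 1)
        (z k + s • f (k + 1) (z k) + √s • u)) ∂(stdGaussian E) := m1.lintegral_prod_right'
    refine (ih (by omega) _ hψ).trans (lintegral_congr fun ω => ?_)
    have hφ' : Measurable fun w => φ (Function.update (pathUpTo B k ω) (k + 1) w) :=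
      (hupd _ measurable_snd).comp (measurable_const.prodMk measurable_id)
    rw [lintegral_stdGaussian_drift (hδ k hk') _ _ hφ', ← lintegral_const_mul _ (by fun_prop)]
    simp_rw [mul_assoc]
    rfl

/-- The path law of the sampling process, by its density with respect to the driftless walk. -/
lemma map_pathUpTo_samplingProcess [IsProbabilityMeasure P] {Ω' : Type*} [MeasurableSpace Ω']
    {P' : Measure Ω'} [IsProbabilityMeasure P'] {N' : ℕ → Ω' → E} (hδ : ∀ k < n, 0 ≤ δ (k + 1))
    (hP : IsGaussianNoise P N n) (hP' : IsGaussianNoise P' N' n) {f : ℕ → E → E}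
    (hf : ∀ k < n, Measurable (f (k + 1))) :
    P'.map (pathUpTo (samplingProcess δ f N') n) =
      (P.map (pathUpTo (samplingProcess δ (fun _ _ => 0) N) n)).withDensity
        (fun z => ENNReal.ofReal (exp (logGirsanov δ f n z))) := by
  have hL := measurable_logGirsanov (δ := δ) hf
  refine Measure.ext_of_lintegral _ fun φ hφ => ?_
  rw [lintegral_map hφ (measurable_pathUpTo (measurable_samplingProcess hP'.measurable hf)),
    lintegral_pathUpTo_samplingProcess hδ hP hP' hf n le_rfl φ hφ,
    lintegral_withDensity_eq_lintegral_mul _ (by fun_prop) hφ, lintegral_map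
      (Measurable.mul (by fun_prop) hφ) (measurable_pathUpTo
        (measurable_samplingProcess hP.measurable (by fun_prop)))]
  rfl

lemma samplingProcess_const_drift (x : E) (k : ℕ) (ω : Ω) :
    samplingProcess δ (fun _ _ => x) N k ω =
      elapsedTime δ k • x + samplingProcess δ (fun _ _ => 0) N k ω := by
  induction k with
  | zero => simp [samplingProcess, elapsedTime]
  | succ k ih =>
    simp only [samplingProcess, ih, elapsedTime_succ, add_smul, smul_zero, add_zero]
    abel

lemma comparisonProcess_eq (X : Ω → E) (k : ℕ) (ω : Ω) :
    comparisonProcess δ X N k ω =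
      elapsedTime δ k • X ω + samplingProcess δ (fun _ _ => 0) N k ω := by
  induction k with
  | zero => simp [samplingProcess, comparisonProcess, elapsedTime]
  | succ k ih =>
    simp only [samplingProcess, comparisonProcess, ih, elapsedTime_succ, add_smul, smul_zero,
      add_zero]
    abel

lemma logGirsanov_const (x : E) {z : ℕ → E} (hz : z 0 = 0) :
    logGirsanov δ (fun _ _ => x) n z = ⟪x, z n⟫ - elapsedTime δ n / 2 * ‖x‖ ^ 2 := by
  rw [logGirsanov, Finset.sum_sub_distrib, ← inner_sum, Finset.sum_range_sub, hz, sub_zero,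
    ← Finset.sum_mul, ← Finset.sum_div]
  rfl

lemma map_samplingProcess_zero_drift [IsProbabilityMeasure P] (hδ : ∀ k < n, 0 ≤ δ (k + 1))
    (hP : IsGaussianNoise P N n) : ∀ k ≤ n,
      P.map (samplingProcess δ (fun _ _ => 0) N k) = scaledGaussian E (elapsedTime δ k) := by
  intro k
  induction k with
  | zero =>
    intro _
    rw [elapsedTime, Finset.sum_range_zero, scaledGaussian_zero]
    simp [samplingProcess, Measure.map_const]
  | succ k ih =>
    intro hk
    have hBm : Measurable (samplingProcess δ (fun _ _ => (0 : E)) N k) :=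
      measurable_samplingProcess hP.measurable (by fun_prop) k (by omega)
    have hNm := hP.measurable k hk
    have hind : IndepFun (samplingProcess δ (fun _ _ => (0 : E)) N k)
        (fun ω => √(δ (k + 1)) • N (k + 1) ω) P := by
      have hm : Measurable fun z : ℕ → E => z k := measurable_pi_apply k
      have h := (hP.indepFun_pathUpTo (δ := δ) (f := fun _ _ => (0 : E)) (by fun_prop) hk).comp
        hm (measurable_const_smul (√(δ (k + 1))) (α := E))
      have e : (fun z : ℕ → E => z k) ∘ pathUpTo (samplingProcess δ (fun _ _ => (0 : E)) N) k =
          samplingProcess δ (fun _ _ => (0 : E)) N k := by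
        exact funext fun ω => pathUpTo_of_le _ le_rfl ω
      rwa [e] at h
    have e : samplingProcess δ (fun _ _ => (0 : E)) N (k + 1) =
        (fun z : E × E => z.1 + z.2) ∘ fun ω =>
          (samplingProcess δ (fun _ _ => (0 : E)) N k ω, √(δ (k + 1)) • N (k + 1) ω) := by
      ext ω; simp [samplingProcess]
    have h0 : 0 ≤ elapsedTime δ k :=
      Finset.sum_nonneg fun j hj => hδ j (by simp at hj; omega)
    have hnoise : P.map (fun ω => √(δ (k + 1)) • N (k + 1) ω) =
        scaledGaussian E (δ (k + 1)) := by
      rw [scaledGaussian, ← hP.map_eq k hk, Measure.map_map (by fun_prop) hNm]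
      rfl
    rw [e, ← Measure.map_map (by fun_prop) (by fun_prop),
      (indepFun_iff_map_prod_eq_prod_map_map (by fun_prop) (by fun_prop)).1 hind, ih (by omega),
      hnoise, scaledGaussian_conv h0 (hδ k hk), elapsedTime_succ]

end Paths

/-! ### The comparison process -/

lemma integrable_inner_of_memLp {Ω : Type*} [MeasurableSpace Ω] {P : Measure Ω} {U V : Ω → E}
    (hU : MemLp U 2 P) (hV : MemLp V 2 P) : Integrable (fun ω => ⟪U ω, V ω⟫) P := by
  have h1 := (memLp_two_iff_integrable_sq_norm hU.1).1 hU
  have h2 := (memLp_two_iff_integrable_sq_norm hV.1).1 hV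
  refine (h1.add h2).mono' (hU.1.inner hV.1) (ae_of_all _ fun ω => ?_)
  have h3 := norm_inner_le_norm (𝕜 := ℝ) (U ω) (V ω)
  have h4 := two_mul_le_add_sq ‖U ω‖ ‖V ω‖
  have h5 : 0 ≤ ‖U ω‖ * ‖V ω‖ := by positivity
  simp only [Pi.add_apply]
  linarith

lemma indepFun_prodMk_left {Ω α β γ : Type*} [MeasurableSpace Ω] [MeasurableSpace α]
    [MeasurableSpace β] [MeasurableSpace γ] {P : Measure Ω} [IsProbabilityMeasure P]
    {U : Ω → α} {V : Ω → β} {W : Ω → γ} (hU : Measurable U) (hV : Measurable V)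
    (hW : Measurable W) (h : IndepFun U (fun ω => (V ω, W ω)) P) (h' : IndepFun V W P) :
    IndepFun (fun ω => (U ω, V ω)) W P := by
  have := Measure.isProbabilityMeasure_map (μ := P) hU.aemeasurable
  have := Measure.isProbabilityMeasure_map (μ := P) hV.aemeasurable
  have := Measure.isProbabilityMeasure_map (μ := P) hW.aemeasurable
  have hUV : IndepFun U V P := h.comp measurable_id measurable_fst
  have e1 := (indepFun_iff_map_prod_eq_prod_map_map hU.aemeasurable
    (hV.prodMk hW).aemeasurable).1 h
  rw [(indepFun_iff_map_prod_eq_prod_map_map hV.aemeasurable hW.aemeasurable).1 h',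
    ← Measure.prodAssoc_prod] at e1
  rw [indepFun_iff_map_prod_eq_prod_map_map (hU.prodMk hV).aemeasurable hW.aemeasurable,
    (indepFun_iff_map_prod_eq_prod_map_map hU.aemeasurable hV.aemeasurable).1 hUV]
  have e2 := congrArg (Measure.map MeasurableEquiv.prodAssoc.symm) e1
  rw [MeasurableEquiv.map_symm_map, Measure.map_map (by fun_prop) (by fun_prop)] at e2
  exact e2

/-- The pull-out property of conditional expectation, for inner products of square-integrable
vectors. -/
lemma integral_inner_condExp {Ω : Type*} [mΩ : MeasurableSpace Ω] {P : Measure Ω}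
    [IsProbabilityMeasure P] {X Y : Ω → E} (hX : MemLp X 2 P) (hY : Measurable Y) {g : E → E}
    (hg : Measurable g) (hgY : MemLp (fun ω => g (Y ω)) 2 P) :
    ∫ ω, ⟪g (Y ω), X ω⟫ ∂P =
      ∫ ω, ⟪g (Y ω), (P[X | MeasurableSpace.comap Y inferInstance]) ω⟫ ∂P := by
  have hm : MeasurableSpace.comap Y inferInstance ≤ mΩ := hY.comap_le
  rw [← integral_condExp hm]
  refine integral_congr_ae ?_
  exact condExp_bilin_of_stronglyMeasurable_left (innerSL ℝ)
    (hg.comp (comap_measurable Y)).stronglyMeasurable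
    (integrable_inner_of_memLp hgY hX) (hX.integrable (by norm_num))

lemma scaledGaussian_withDensity_channelDensity (μ : Measure E) [IsFiniteMeasure μ] {t : ℝ}
    (ht : 0 ≤ t) :
    (μ.prod (scaledGaussian E t)).map (fun z => z.2 + t • z.1) =
      (scaledGaussian E t).withDensity (fun w => ENNReal.ofReal (channelDensity μ t w)) := by
  refine Measure.ext_of_lintegral _ fun φ hφ => ?_
  have h1 := congrArg (fun ν => ∫⁻ z, φ z.2 ∂ν) (prod_scaledGaussian_map μ ht)
  rw [lintegral_map (by fun_prop) (by fun_prop),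
    lintegral_withDensity_eq_lintegral_mul _ (by fun_prop) (by fun_prop)] at h1
  rw [lintegral_map hφ (by fun_prop)]
  refine h1.trans ?_
  rw [lintegral_prod_symm _ (by fun_prop),
    lintegral_withDensity_eq_lintegral_mul _ (by fun_prop) hφ]
  refine lintegral_congr_ae ?_
  filter_upwards [ae_integrable_cmDensity μ ht] with w hw
  simp only [Pi.mul_apply]
  rw [lintegral_mul_const _ (by fun_prop), channelDensity,
    ofReal_integral_eq_lintegral_ofReal hw (ae_of_all _ fun x => (cmDensity_pos _ _ _).le)]

section Comparison

variable {Ω : Type*} [MeasurableSpace Ω] {P : Measure Ω} [IsProbabilityMeasure P] {X : Ω → E}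
  {N : ℕ → Ω → E} {δ : ℕ → ℝ} {n : ℕ}

lemma indepFun_driftless (hXN : IndepFun X (fun ω (k : Fin n) => N (k + 1) ω) P) {α : Type*}
    [mα : MeasurableSpace α] {W : Ω → α}
    (hW : ∀ m : MeasurableSpace Ω, (∀ j < n, Measurable[m] (N (j + 1))) → Measurable[m] W) :
    IndepFun X W P := by
  rw [IndepFun_iff_Indep] at hXN ⊢
  refine indep_of_indep_of_le_right hXN ?_
  rw [← measurable_iff_comap_le]
  let m : MeasurableSpace Ω :=
    MeasurableSpace.comap (fun ω (j : Fin n) => N (j + 1) ω) inferInstance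
  have hm : Measurable[m] (fun ω (j : Fin n) => N (j + 1) ω) := comap_measurable _
  exact hW m fun j hj => (measurable_pi_apply (⟨j, hj⟩ : Fin n)).comp hm

lemma indepFun_pathUpTo_driftless (hXN : IndepFun X (fun ω (k : Fin n) => N (k + 1) ω) P) :
    IndepFun X (pathUpTo (samplingProcess δ (fun _ _ => 0) N) n) P :=
  indepFun_driftless hXN fun _ hm =>
    measurable_pathUpTo (measurable_samplingProcess hm fun _ _ => measurable_const)

lemma measurable_comparisonProcess (hX : Measurable X) (hN : IsGaussianNoise P N n) {k : ℕ}
    (hk : k ≤ n) : Measurable (comparisonProcess δ X N k) := by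
  have h := measurable_samplingProcess (δ := δ) (f := fun _ _ => (0 : E)) hN.measurable
    (fun _ _ => measurable_const) k hk
  have e : comparisonProcess δ X N k = fun ω => elapsedTime δ k • X ω +
    samplingProcess δ (fun _ _ => (0 : E)) N k ω := funext fun ω => comparisonProcess_eq X k ω
  rw [e]
  fun_prop

/-- The joint law of `X` and the driftless walk at time `k`. -/
lemma map_prodMk_driftless (hX : Measurable X) (hN : IsGaussianNoise P N n)
    (hXN : IndepFun X (fun ω (k : Fin n) => N (k + 1) ω) P) (hδ : ∀ k < n, 0 ≤ δ (k + 1)) {k : ℕ}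
    (hk : k ≤ n) :
    P.map (fun ω => (X ω, samplingProcess δ (fun _ _ => 0) N k ω)) =
      (P.map X).prod (scaledGaussian E (elapsedTime δ k)) := by
  have h := measurable_samplingProcess (δ := δ) (f := fun _ _ => (0 : E)) hN.measurable
    (fun _ _ => measurable_const) k hk
  rw [← map_samplingProcess_zero_drift hδ hN k hk,
    (indepFun_iff_map_prod_eq_prod_map_map hX.aemeasurable h.aemeasurable).1
      (indepFun_driftless hXN fun _ hm =>
        measurable_samplingProcess hm (fun _ _ => measurable_const) k hk)]

lemma map_prodMk_comparisonProcess (hX : Measurable X) (hN : IsGaussianNoise P N n)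
    (hXN : IndepFun X (fun ω (k : Fin n) => N (k + 1) ω) P) (hδ : ∀ k < n, 0 ≤ δ (k + 1)) {k : ℕ}
    (hk : k ≤ n) :
    P.map (fun ω => (X ω, comparisonProcess δ X N k ω)) =
      ((P.map X).prod (scaledGaussian E (elapsedTime δ k))).map
        (fun z => (z.1, z.2 + elapsedTime δ k • z.1)) := by
  have h := measurable_samplingProcess (δ := δ) (f := fun _ _ => (0 : E)) hN.measurable
    (fun _ _ => measurable_const) k hk
  rw [← map_prodMk_driftless hX hN hXN hδ hk, Measure.map_map (by fun_prop) (by fun_prop)]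
  congr 1
  ext ω
  · rfl
  · simp only [Function.comp_apply, comparisonProcess_eq, add_comm]

lemma map_comparisonProcess (hX : Measurable X) (hN : IsGaussianNoise P N n)
    (hXN : IndepFun X (fun ω (k : Fin n) => N (k + 1) ω) P) (hδ : ∀ k < n, 0 ≤ δ (k + 1)) {k : ℕ}
    (hk : k ≤ n) :
    P.map (comparisonProcess δ X N k) =
      (scaledGaussian E (elapsedTime δ k)).withDensity
        (fun w => ENNReal.ofReal (channelDensity (P.map X) (elapsedTime δ k) w)) := by
  have := Measure.isProbabilityMeasure_map (μ := P) hX.aemeasurable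
  have h0 : 0 ≤ elapsedTime δ k := Finset.sum_nonneg fun j hj => hδ j (by simp at hj; omega)
  have hY := measurable_comparisonProcess (δ := δ) hX hN hk
  have h := congrArg (Measure.map Prod.snd) (map_prodMk_comparisonProcess hX hN hXN hδ hk)
  rw [Measure.map_map (by fun_prop) (by fun_prop), Measure.map_map (by fun_prop) (by fun_prop)] at h
  rw [← scaledGaussian_withDensity_channelDensity _ h0]
  exact h

/-- The path law of the comparison process, by its density with respect to the driftless walk:
a mixture of Girsanov densities for constant drifts, which only depends on the endpoint. -/
lemma map_pathUpTo_comparisonProcess (hX : Measurable X) (hN : IsGaussianNoise P N n)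
    (hXN : IndepFun X (fun ω (k : Fin n) => N (k + 1) ω) P) (hδ : ∀ k < n, 0 ≤ δ (k + 1)) :
    P.map (pathUpTo (comparisonProcess δ X N) n) =
      (P.map (pathUpTo (samplingProcess δ (fun _ _ => 0) N) n)).withDensity
        (fun z => ENNReal.ofReal (channelDensity (P.map X) (elapsedTime δ n) (z n))) := by
  have := Measure.isProbabilityMeasure_map (μ := P) hX.aemeasurable
  have h0 : 0 ≤ elapsedTime δ n := Finset.sum_nonneg fun j hj => hδ j (by simpa using hj)
  set B := samplingProcess δ (fun _ _ => (0 : E)) N with hB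
  have hBk : ∀ k ≤ n, Measurable (B k) := measurable_samplingProcess hN.measurable
    (fun _ _ => measurable_const)
  have hBm := measurable_pathUpTo hBk
  have hYm := measurable_pathUpTo fun k hk =>
    measurable_comparisonProcess (δ := δ) hX hN (k := k) hk
  -- the path of the walk with constant drift `x`, as a function of `x` and of the driftless path
  let S : (ℕ → E) × E → ℕ → E := fun z k => if k ≤ n then elapsedTime δ k • z.2 + z.1 k else 0
  have hS : Measurable S := by
    refine measurable_pi_lambda _ fun k => ?_
    by_cases hk : k ≤ n
    · simp only [S, if_pos hk]; fun_prop
    · simp only [S, if_neg hk]; fun_prop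
  have eY : ∀ ω, pathUpTo (comparisonProcess δ X N) n ω = S (pathUpTo B n ω, X ω) := by
    intro ω; ext k
    by_cases hk : k ≤ n
    · simp only [pathUpTo, S, if_pos hk, comparisonProcess_eq, hB]
    · simp only [pathUpTo, S, if_neg hk]
  have eZ : ∀ x ω, pathUpTo (samplingProcess δ (fun _ _ => x) N) n ω = S (pathUpTo B n ω, x) := by
    intro x ω; ext k
    by_cases hk : k ≤ n
    · simp only [pathUpTo, S, if_pos hk, samplingProcess_const_drift x, hB]
    · simp only [pathUpTo, S, if_neg hk]
  have hBn : Measurable (B n) := hBk n le_rfl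
  refine Measure.ext_of_lintegral _ fun φ hφ => ?_
  have hind := lintegral_indepFun hBm hX (indepFun_pathUpTo_driftless (δ := δ) hXN).symm
    (hφ.comp hS)
  simp only [Function.comp_apply] at hind
  have hBφ : Measurable fun ω => φ (pathUpTo B n ω) := hφ.comp hBm
  rw [lintegral_map hφ hYm]
  simp_rw [eY]
  have hsw : Measurable fun p : Ω × E => φ (S (pathUpTo B n p.1, p.2)) :=
    (hφ.comp hS).comp ((hBm.comp measurable_fst).prodMk measurable_snd)
  rw [hind, lintegral_lintegral_swap hsw.aemeasurable]
  have hx : ∀ x, ∫⁻ ω, φ (S (pathUpTo B n ω, x)) ∂P =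
      ∫⁻ ω, ENNReal.ofReal (cmDensity (elapsedTime δ n) x (B n ω)) * φ (pathUpTo B n ω) ∂P := by
    intro x
    simp_rw [← eZ]
    rw [lintegral_pathUpTo_samplingProcess hδ hN hN (fun _ _ => measurable_const) n le_rfl φ hφ]
    refine lintegral_congr fun ω => ?_
    rw [logGirsanov_const x (by rw [pathUpTo_of_le _ (Nat.zero_le n)]; rfl),
      pathUpTo_of_le _ le_rfl]
    rfl
  simp_rw [hx]
  have hmeas : Measurable fun p : E × Ω =>
      ENNReal.ofReal (cmDensity (elapsedTime δ n) p.1 (B n p.2)) * φ (pathUpTo B n p.2) :=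
    Measurable.mul (by fun_prop) (hBφ.comp measurable_snd)
  rw [lintegral_lintegral_swap hmeas.aemeasurable,
    lintegral_withDensity_eq_lintegral_mul _ (by fun_prop) hφ,
    lintegral_map (Measurable.mul (by fun_prop) hφ) hBm]
  refine lintegral_congr_ae ?_
  have hae := ae_integrable_cmDensity (P.map X) h0
  rw [← map_samplingProcess_zero_drift hδ hN n le_rfl] at hae
  filter_upwards [ae_of_ae_map hBn.aemeasurable hae] with ω hω
  rw [lintegral_mul_const _ (by fun_prop), Pi.mul_apply, pathUpTo_of_le _ le_rfl, channelDensity,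
    ofReal_integral_eq_lintegral_ofReal hω (ae_of_all _ fun x => (cmDensity_pos _ _ _).le)]

lemma ae_channelDensity_driftless_pos (hX : Measurable X) (hN : IsGaussianNoise P N n)
    (hδ : ∀ k < n, 0 ≤ δ (k + 1)) :
    ∀ᵐ z ∂(P.map (pathUpTo (samplingProcess δ (fun _ _ => 0) N) n)),
      0 < channelDensity (P.map X) (elapsedTime δ n) (z n) := by
  have := Measure.isProbabilityMeasure_map (μ := P) hX.aemeasurable
  have h0 : 0 ≤ elapsedTime δ n := Finset.sum_nonneg fun j hj => hδ j (by simpa using hj)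
  have hB := measurable_samplingProcess (δ := δ) (f := fun _ _ => (0 : E)) hN.measurable
    (fun _ _ => measurable_const)
  have hae := ae_channelDensity_pos (μ := P.map X) h0
  rw [← map_samplingProcess_zero_drift hδ hN n le_rfl] at hae
  rw [ae_map_iff (measurable_pathUpTo hB).aemeasurable
    (measurableSet_lt measurable_const (by fun_prop))]
  filter_upwards [ae_of_ae_map (hB n le_rfl).aemeasurable hae] with ω hω
  rwa [pathUpTo_of_le _ le_rfl]

/-- The expected log-density at the endpoint is the channel entropy. -/
lemma integral_log_channelDensity (hX : Measurable X)
    (hX2 : Integrable (fun x => ‖x‖ ^ 2) (P.map X)) (hN : IsGaussianNoise P N n)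
    (hXN : IndepFun X (fun ω (k : Fin n) => N (k + 1) ω) P) (hδ : ∀ k < n, 0 ≤ δ (k + 1)) :
    Integrable (fun ω => log (channelDensity (P.map X) (elapsedTime δ n)
        (comparisonProcess δ X N n ω))) P ∧
      ∫ ω, log (channelDensity (P.map X) (elapsedTime δ n) (comparisonProcess δ X N n ω)) ∂P =
        channelEntropy (P.map X) (elapsedTime δ n) := by
  have := Measure.isProbabilityMeasure_map (μ := P) hX.aemeasurable
  have h0 : 0 ≤ elapsedTime δ n := Finset.sum_nonneg fun j hj => hδ j (by simpa using hj)
  have hY := measurable_comparisonProcess (δ := δ) hX hN le_rfl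
  have hlog : Measurable fun w => log (channelDensity (P.map X) (elapsedTime δ n) w) := by fun_prop
  have hi := integrable_channelDensity_mul_log h0 hX2 (by simp)
  have e1 := integrable_map_measure (μ := P) hlog.aestronglyMeasurable hY.aemeasurable
  have e2 := integral_map (μ := P) hY.aemeasurable hlog.aestronglyMeasurable
  rw [map_comparisonProcess hX hN hXN hδ le_rfl] at e1 e2
  rw [integrable_withDensity_iff_integrable_smul' (by fun_prop) (by simp)] at e1
  rw [integral_withDensity_eq_integral_toReal_smul (by fun_prop) (by simp)] at e2
  simp_rw [ENNReal.toReal_ofReal (channelDensity_nonneg _ _ _), smul_eq_mul] at e1 e2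
  exact ⟨e1.1 hi, e2.symm⟩

/-- The energy of the posterior mean is at most the energy of the conditional expectation of `X`
given `Y_k` (in fact they agree). -/
lemma posteriorEnergy_le_condExp (hX : Measurable X)
    (hX2 : Integrable (fun x => ‖x‖ ^ 2) (P.map X)) (hN : IsGaussianNoise P N n)
    (hXN : IndepFun X (fun ω (k : Fin n) => N (k + 1) ω) P) (hδ : ∀ k < n, 0 ≤ δ (k + 1)) {k : ℕ}
    (hk : k ≤ n) :
    posteriorEnergy (P.map X) (elapsedTime δ k) ≤
      ∫ ω, ‖(P[X | MeasurableSpace.comap (comparisonProcess δ X N k) inferInstance]) ω‖ ^ 2 ∂P := by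
  have := Measure.isProbabilityMeasure_map (μ := P) hX.aemeasurable
  set μ := P.map X with hμ
  set t := elapsedTime δ k with ht
  set Y := comparisonProcess δ X N k with hYdef
  have h0 : 0 ≤ t := Finset.sum_nonneg fun j hj => hδ j (by simp at hj; omega)
  have hY : Measurable Y := measurable_comparisonProcess (δ := δ) hX hN hk
  have hXL : MemLp X 2 P := by
    rw [memLp_two_iff_integrable_sq_norm hX.aestronglyMeasurable]
    exact (integrable_map_measure (f := X) (by fun_prop) hX.aemeasurable).1 hX2
  let m : E → E := fun w => (channelDensity μ t w)⁻¹ • channelMoment μ t w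
  have hm : Measurable m := by fun_prop
  -- the second moment of the posterior mean
  have e : ∀ w, channelDensity μ t w * ‖m w‖ ^ 2 =
      ‖channelMoment μ t w‖ ^ 2 / channelDensity μ t w := by
    intro w
    simp only [m, norm_smul, mul_pow, norm_eq_abs, sq_abs]
    by_cases h : channelDensity μ t w = 0
    · simp [h]
    · field_simp
  have hms : Measurable fun w => ‖m w‖ ^ 2 := by fun_prop
  have e1 := integrable_map_measure (μ := P) hms.aestronglyMeasurable hY.aemeasurable
  have e2 := integral_map (μ := P) hY.aemeasurable hms.aestronglyMeasurable
  rw [map_comparisonProcess hX hN hXN hδ hk] at e1 e2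
  rw [integrable_withDensity_iff_integrable_smul' (by fun_prop) (by simp)] at e1
  rw [integral_withDensity_eq_integral_toReal_smul (by fun_prop) (by simp)] at e2
  simp_rw [ENNReal.toReal_ofReal (channelDensity_nonneg _ _ _), smul_eq_mul] at e1 e2
  simp_rw [← hμ, ← ht, e] at e1 e2
  have hmY : MemLp (fun ω => m (Y ω)) 2 P := by
    have hmYm : Measurable fun ω => m (Y ω) := hm.comp hY
    rw [memLp_two_iff_integrable_sq_norm hmYm.aestronglyMeasurable]
    exact e1.1 (integrable_posteriorEnergy h0 hX2)
  -- the correlation of the posterior mean with `X`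
  have e3 : ∫ ω, ⟪m (Y ω), X ω⟫ ∂P = posteriorEnergy μ t := by
    have hψm : StronglyMeasurable fun z : E × E => ⟪m z.2, z.1⟫ :=
      (Measurable.inner (by fun_prop) (by fun_prop)).stronglyMeasurable
    have hXY : Measurable fun ω => (X ω, Y ω) := by fun_prop
    have e4 := integral_map (μ := P) hXY.aemeasurable hψm.aestronglyMeasurable
    have e5 := integrable_map_measure (μ := P) hψm.aestronglyMeasurable hXY.aemeasurable
    rw [map_prodMk_comparisonProcess hX hN hXN hδ hk, ← hμ, ← ht] at e4 e5
    rw [integrable_map_measure hψm.aestronglyMeasurable (by fun_prop)] at e5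
    rw [integral_map (by fun_prop) hψm.aestronglyMeasurable] at e4
    have hint := e5.2 (integrable_inner_of_memLp hmY hXL)
    have hint' := (integrable_joint_iff h0 hψm).2 hint
    rw [← e4, ← integral_joint h0 hψm, integral_prod_symm _ hint', posteriorEnergy]
    refine integral_congr_ae ?_
    filter_upwards [ae_integrable_cmDensity_smul h0 (g := fun x => x) stronglyMeasurable_id
      (integrable_id_of_sq hX2)] with w hw
    simp only [smul_eq_mul, ← real_inner_smul_right]
    rw [integral_inner hw]
    change ⟪m w, channelMoment μ t w⟫ = _
    rw [real_inner_smul_left, real_inner_self_eq_norm_sq, div_eq_inv_mul]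
  set c := P[X | MeasurableSpace.comap Y inferInstance] with hc
  have hcL : MemLp c 2 P := hXL.condExp (by norm_num)
  rw [integral_inner_condExp hXL hY hm hmY] at e3
  have i1 := (memLp_two_iff_integrable_sq_norm hmY.1).1 hmY
  have i2 := (memLp_two_iff_integrable_sq_norm hcL.1).1 hcL
  have h4 : ∫ ω, ⟪m (Y ω), c ω⟫ ∂P ≤ ∫ ω, (‖m (Y ω)‖ ^ 2 / 2 + ‖c ω‖ ^ 2 / 2) ∂P := by
    refine integral_mono (integrable_inner_of_memLp hmY hcL)
      ((i1.div_const 2).add (i2.div_const 2)) fun ω => ?_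
    have h5 := real_inner_le_norm (m (Y ω)) (c ω)
    have h6 := two_mul_le_add_sq ‖m (Y ω)‖ ‖c ω‖
    simp only
    linarith
  rw [integral_add (i1.div_const 2) (i2.div_const 2), integral_div, integral_div, e3, ← e2] at h4
  change _ ≤ posteriorEnergy μ t / 2 + _ at h4
  linarith

/-- The noise in step `k + 1` is centred given the past of the comparison process. -/
lemma integral_inner_noise (hX : Measurable X) (hN : IsGaussianNoise P N n)
    (hXN : IndepFun X (fun ω (k : Fin n) => N (k + 1) ω) P) {k : ℕ} (hk : k < n) {g : E → E}
    (hg : Measurable g) (hgY : MemLp (fun ω => g (comparisonProcess δ X N k ω)) 2 P) :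
    MemLp (N (k + 1)) 2 P ∧
      ∫ ω, ⟪g (comparisonProcess δ X N k ω), N (k + 1) ω⟫ ∂P = 0 := by
  set Y := comparisonProcess δ X N k with hYdef
  have hY : Measurable Y := measurable_comparisonProcess (δ := δ) hX hN hk.le
  have hNk := hN.measurable k hk
  have hNL : MemLp (N (k + 1)) 2 P := by
    have h := IsGaussian.memLp_two_id (μ := stdGaussian E)
    rw [← hN.map_eq k hk, memLp_map_measure_iff (by fun_prop) hNk.aemeasurable] at h
    exact h
  refine ⟨hNL, ?_⟩
  set B := samplingProcess δ (fun _ _ => (0 : E)) N with hB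
  have hBm : Measurable (pathUpTo B k) := measurable_pathUpTo fun j hj =>
    measurable_samplingProcess hN.measurable (fun _ _ => measurable_const) j (by omega)
  have h1 : IndepFun X (fun ω => (pathUpTo B k ω, N (k + 1) ω)) P :=
    indepFun_driftless hXN fun m hm =>
      Measurable.prodMk (measurable_pathUpTo fun j hj =>
        measurable_samplingProcess hm (fun _ _ => measurable_const) j (by omega)) (hm k hk)
  have h2 := indepFun_prodMk_left hX hBm hNk h1
    (hN.indepFun_pathUpTo (fun _ _ => measurable_const) hk)
  have hq : Measurable fun z : E × (ℕ → E) => elapsedTime δ k • z.1 + z.2 k := by fun_prop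
  have h3 : IndepFun Y (N (k + 1)) P := by
    have h4 := h2.comp hq measurable_id
    have e : (fun z : E × (ℕ → E) => elapsedTime δ k • z.1 + z.2 k) ∘
        (fun ω => (X ω, pathUpTo B k ω)) = Y := by
      ext ω
      simp only [Function.comp_apply, hYdef, comparisonProcess_eq]
      rw [pathUpTo_of_le _ le_rfl]
    rwa [e] at h4
  have h5 : IndepFun (fun ω => g (Y ω)) (N (k + 1)) P := h3.comp hg measurable_id
  have hgm : Measurable fun ω => g (Y ω) := hg.comp hY
  have h6 := (indepFun_iff_map_prod_eq_prod_map_map hgm.aemeasurable hNk.aemeasurable).1 h5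
  have := Measure.isProbabilityMeasure_map (μ := P) hgm.aemeasurable
  have hψ : Continuous fun z : E × E => ⟪z.1, z.2⟫ := by fun_prop
  have e1 := integral_map (μ := P) (hgm.prodMk hNk).aemeasurable
    hψ.stronglyMeasurable.aestronglyMeasurable
  have e2 := (integrable_map_measure (μ := P) hψ.stronglyMeasurable.aestronglyMeasurable
    (hgm.prodMk hNk).aemeasurable).2 (integrable_inner_of_memLp hgY hNL)
  rw [h6, hN.map_eq k hk] at e1 e2
  rw [← e1, integral_prod _ e2]
  have h7 : ∀ x : E, ∫ y, ⟪x, y⟫ ∂(stdGaussian E) = 0 := by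
    intro x
    rw [integral_inner (f := fun y : E => y) IsGaussian.integrable_id, integral_id_stdGaussian,
      inner_zero_right]
  simp [h7]

end Comparison

/-! ### The divergence between the path laws -/

section Divergence

variable {Ω : Type*} [MeasurableSpace Ω] {P : Measure Ω} [IsProbabilityMeasure P] {X : Ω → E}
  {N : ℕ → Ω → E} {δ : ℕ → ℝ} {n : ℕ}

/-- The expected logarithm of Girsanov's density along the comparison process: completing the square
around the conditional expectation of `X` leaves the drift error. -/
lemma integral_logGirsanov_comparisonProcess (hX : Measurable X) (hX2 : MemLp X 2 P)
    (hN : IsGaussianNoise P N n) (hXN : IndepFun X (fun ω (k : Fin n) => N (k + 1) ω) P)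
    {f : ℕ → E → E} (hf : ∀ k < n, Measurable (f (k + 1)))
    (hfY : ∀ k < n, MemLp (fun ω => f (k + 1) (comparisonProcess δ X N k ω)) 2 P) :
    Integrable (fun ω => logGirsanov δ f n (pathUpTo (comparisonProcess δ X N) n ω)) P ∧
      ∫ ω, logGirsanov δ f n (pathUpTo (comparisonProcess δ X N) n ω) ∂P =
        ∑ k ∈ Finset.range n, δ (k + 1) / 2 *
          (∫ ω, ‖(P[X | MeasurableSpace.comap (comparisonProcess δ X N k) inferInstance]) ω‖ ^ 2
              ∂P -
            ∫ ω, ‖f (k + 1) (comparisonProcess δ X N k ω) -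
              (P[X | MeasurableSpace.comap (comparisonProcess δ X N k) inferInstance]) ω‖ ^ 2
              ∂P) := by
  set Y := comparisonProcess δ X N with hYdef
  have hlog : ∀ ω, logGirsanov δ f n (pathUpTo Y n ω) = ∑ k ∈ Finset.range n,
      (δ (k + 1) * ⟪f (k + 1) (Y k ω), X ω⟫ +
        √(δ (k + 1)) * ⟪f (k + 1) (Y k ω), N (k + 1) ω⟫ -
          δ (k + 1) / 2 * ‖f (k + 1) (Y k ω)‖ ^ 2) := by
    intro ω
    refine Finset.sum_congr rfl fun k hk => ?_
    have hk' : k < n := by simpa using hk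
    rw [pathUpTo_of_le Y hk'.le, pathUpTo_of_le Y hk']
    have e : Y (k + 1) ω - Y k ω = δ (k + 1) • X ω + √(δ (k + 1)) • N (k + 1) ω := by
      simp only [hYdef, comparisonProcess]
      abel
    rw [e, inner_add_right, real_inner_smul_right, real_inner_smul_right]
  simp_rw [hlog]
  have hterm : ∀ k < n,
      Integrable (fun ω => δ (k + 1) * ⟪f (k + 1) (Y k ω), X ω⟫ +
        √(δ (k + 1)) * ⟪f (k + 1) (Y k ω), N (k + 1) ω⟫ -
          δ (k + 1) / 2 * ‖f (k + 1) (Y k ω)‖ ^ 2) P ∧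
      ∫ ω, (δ (k + 1) * ⟪f (k + 1) (Y k ω), X ω⟫ +
        √(δ (k + 1)) * ⟪f (k + 1) (Y k ω), N (k + 1) ω⟫ -
          δ (k + 1) / 2 * ‖f (k + 1) (Y k ω)‖ ^ 2) ∂P =
        δ (k + 1) / 2 *
          (∫ ω, ‖(P[X | MeasurableSpace.comap (Y k) inferInstance]) ω‖ ^ 2 ∂P -
            ∫ ω, ‖f (k + 1) (Y k ω) -
              (P[X | MeasurableSpace.comap (Y k) inferInstance]) ω‖ ^ 2 ∂P) := by
    intro k hk
    have hY : Measurable (Y k) := measurable_comparisonProcess hX hN hk.le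
    set F : Ω → E := fun ω => f (k + 1) (Y k ω) with hF
    have hFL : MemLp F 2 P := hfY k hk
    obtain ⟨hNL, hN0⟩ := integral_inner_noise (δ := δ) hX hN hXN hk (hf k hk) hFL
    set c := P[X | MeasurableSpace.comap (Y k) inferInstance] with hc
    have hcL : MemLp c 2 P := hX2.condExp (by norm_num)
    have i1 := (integrable_inner_of_memLp hFL hX2).const_mul (δ (k + 1))
    have i2 := (integrable_inner_of_memLp hFL hNL).const_mul √(δ (k + 1))
    have iF := (memLp_two_iff_integrable_sq_norm hFL.1).1 hFL
    have ic := (memLp_two_iff_integrable_sq_norm hcL.1).1 hcL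
    have iFc := integrable_inner_of_memLp hFL hcL
    have i3 := iF.const_mul (δ (k + 1) / 2)
    have i12 : Integrable (fun ω => δ (k + 1) * ⟪F ω, X ω⟫ +
      √(δ (k + 1)) * ⟪F ω, N (k + 1) ω⟫) P := i1.add i2
    refine ⟨i12.sub i3, ?_⟩
    have hN0' : ∫ ω, ⟪F ω, N (k + 1) ω⟫ ∂P = 0 := hN0
    have hpull : ∫ ω, ⟪F ω, X ω⟫ ∂P = ∫ ω, ⟪F ω, c ω⟫ ∂P :=
      integral_inner_condExp hX2 hY (hf k hk) hFL
    have hsq : ∫ ω, ‖F ω - c ω‖ ^ 2 ∂P =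
        ∫ ω, ‖F ω‖ ^ 2 ∂P - 2 * ∫ ω, ⟪F ω, c ω⟫ ∂P + ∫ ω, ‖c ω‖ ^ 2 ∂P := by
      have i4 : Integrable (fun ω => ‖F ω‖ ^ 2 - 2 * ⟪F ω, c ω⟫) P := iF.sub (iFc.const_mul 2)
      simp_rw [norm_sub_sq_real]
      rw [integral_add i4 ic, integral_sub iF (iFc.const_mul 2), integral_const_mul]
    rw [integral_sub i12 i3, integral_add i1 i2, integral_const_mul, integral_const_mul,
      integral_const_mul, hN0', hpull, hsq]
    ring
  have hint : ∀ k ∈ Finset.range n, Integrable (fun ω => δ (k + 1) * ⟪f (k + 1) (Y k ω), X ω⟫ +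
        √(δ (k + 1)) * ⟪f (k + 1) (Y k ω), N (k + 1) ω⟫ -
          δ (k + 1) / 2 * ‖f (k + 1) (Y k ω)‖ ^ 2) P :=
    fun k hk => (hterm k (by simpa using hk)).1
  refine ⟨integrable_finsetSum _ hint, ?_⟩
  rw [integral_finsetSum _ hint]
  exact Finset.sum_congr rfl fun k hk => (hterm k (by simpa using hk)).2

/-- Data processing bounds the divergence of the path laws by an expected log-likelihood ratio. -/
lemma klDiv_pathLaw_le (hX : Measurable X) (hX2 : MemLp X 2 P) (hN : IsGaussianNoise P N n)
    (hXN : IndepFun X (fun ω (k : Fin n) => N (k + 1) ω) P) (hδ : ∀ k < n, 0 ≤ δ (k + 1))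
    {Ω' : Type*} [MeasurableSpace Ω'] {P' : Measure Ω'} [IsProbabilityMeasure P']
    {N' : ℕ → Ω' → E} (hN' : IsGaussianNoise P' N' n)
    {f : ℕ → E → E} (hf : ∀ k < n, Measurable (f (k + 1)))
    (hfY : ∀ k < n, MemLp (fun ω => f (k + 1) (comparisonProcess δ X N k ω)) 2 P) :
    InformationTheory.klDiv (pathLaw P (comparisonProcess δ X N) n)
        (pathLaw P' (samplingProcess δ f N') n) ≤
      ENNReal.ofReal (channelEntropy (P.map X) (elapsedTime δ n) -
        ∫ ω, logGirsanov δ f n (pathUpTo (comparisonProcess δ X N) n ω) ∂P) := by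
  have := Measure.isProbabilityMeasure_map (μ := P) hX.aemeasurable
  have hXsq : Integrable (fun x => ‖x‖ ^ 2) (P.map X) := by
    rw [integrable_map_measure (by fun_prop) hX.aemeasurable]
    exact (memLp_two_iff_integrable_sq_norm hX2.1).1 hX2
  have hYm : ∀ k ≤ n, Measurable (comparisonProcess δ X N k) :=
    fun k hk => measurable_comparisonProcess hX hN hk
  have hZm := measurable_samplingProcess (δ := δ) hN'.measurable hf
  have hpY := measurable_pathUpTo hYm
  have hpZ := measurable_pathUpTo hZm
  have iY := Measure.isProbabilityMeasure_map (μ := P) hpY.aemeasurable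
  have iZ := Measure.isProbabilityMeasure_map (μ := P') hpZ.aemeasurable
  rw [pathLaw_eq_map P hYm, pathLaw_eq_map P' hZm]
  refine (InformationTheory.klDiv_map_le _ _ (by fun_prop)).trans (le_of_eq ?_)
  have eY := map_pathUpTo_comparisonProcess hX hN hXN hδ
  have eZ := map_pathUpTo_samplingProcess hδ hN hN' hf
  have hLm := measurable_logGirsanov (δ := δ) hf
  obtain ⟨l1, l2⟩ := integral_log_channelDensity hX hXsq hN hXN hδ
  obtain ⟨g1, -⟩ := integral_logGirsanov_comparisonProcess (δ := δ) hX hX2 hN hXN hf hfY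
  have hm : Measurable fun z : ℕ → E =>
      log (channelDensity (P.map X) (elapsedTime δ n) (z n)) - logGirsanov δ f n z := by fun_prop
  have hi : Integrable (fun z : ℕ → E =>
      log (channelDensity (P.map X) (elapsedTime δ n) (z n)) - logGirsanov δ f n z)
      (P.map (pathUpTo (comparisonProcess δ X N) n)) := by
    rw [integrable_map_measure hm.aestronglyMeasurable hpY.aemeasurable]
    refine (l1.sub g1).congr (ae_of_all _ fun ω => ?_)
    simp only [Pi.sub_apply, Function.comp_apply, pathUpTo_of_le _ le_rfl]
  have hval : ∫ z, (log (channelDensity (P.map X) (elapsedTime δ n) (z n)) - logGirsanov δ f n z)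
      ∂(P.map (pathUpTo (comparisonProcess δ X N) n)) =
      channelEntropy (P.map X) (elapsedTime δ n) -
        ∫ ω, logGirsanov δ f n (pathUpTo (comparisonProcess δ X N) n ω) ∂P := by
    rw [integral_map hpY.aemeasurable hm.aestronglyMeasurable, ← l2, ← integral_sub l1 g1]
    simp only [pathUpTo_of_le _ le_rfl]
  rw [← hval]
  rw [eY] at hi iY ⊢
  rw [eZ] at iZ ⊢
  have := Measure.isProbabilityMeasure_map (μ := P)
    (measurable_pathUpTo (measurable_samplingProcess (δ := δ) (f := fun _ _ => (0 : E))
      hN.measurable (fun _ _ => measurable_const) (n := n))).aemeasurable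
  exact klDiv_withDensity_eq (a := fun z : ℕ → E =>
    channelDensity (P.map X) (elapsedTime δ n) (z n)) (by fun_prop) hLm
    (ae_channelDensity_driftless_pos hX hN hδ) hi

end Divergence

lemma trace_covarianceMatrix {Ω : Type*} [MeasurableSpace Ω] {P : Measure Ω}
    [IsProbabilityMeasure P] {d : ℕ} {X : Ω → EuclideanSpace ℝ (Fin d)} (hX : MemLp X 2 P) :
    (covarianceMatrix X P).trace = ∫ ω, ‖X ω‖ ^ 2 ∂P - ‖∫ ω, X ω ∂P‖ ^ 2 := by
  have hXi : ∀ i, MemLp (fun ω => X ω i) 2 P := fun i =>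
    (EuclideanSpace.proj (𝕜 := ℝ) i).comp_memLp' hX
  have hi : ∀ i, (∫ ω, X ω ∂P) i = ∫ ω, X ω i ∂P := fun i =>
    ((EuclideanSpace.proj (𝕜 := ℝ) i).integral_comp_comm (hX.integrable (by norm_num))).symm
  simp only [Matrix.trace, Matrix.diag, covarianceMatrix, Matrix.of_apply,
    EuclideanSpace.real_norm_sq_eq, hi]
  rw [integral_finsetSum _ fun i _ => (hXi i).integrable_sq, ← Finset.sum_sub_distrib]
  refine Finset.sum_congr rfl fun i _ => ?_
  rw [covariance_eq_sub (hXi i) (hXi i), sq]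
  simp only [Pi.mul_apply, sq]

lemma sum_Icc_one_eq_sum_range (g : ℕ → ℝ) (n : ℕ) :
    ∑ k ∈ Finset.Icc 1 n, g k = ∑ k ∈ Finset.range n, g (k + 1) := by
  induction n with
  | zero => simp
  | succ n ih => rw [Finset.sum_Icc_succ_top (by omega), ih, Finset.sum_range_succ]

end DiffusionSampling

open DiffusionSampling in
theorem theorem1 {d n : ℕ} (hn : 1 ≤ n)
    -- the target distribution, with finite second moments
    (μ : Measure (EuclideanSpace ℝ (Fin d))) [IsProbabilityMeasure μ]
    (hμ : Integrable (fun x => ‖x‖ ^ 2) μ)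
    -- step sizes and drift functions
    (δ : ℕ → ℝ) (hδ : ∀ k ∈ Finset.Icc 1 n, 0 < δ k)
    (f : ℕ → EuclideanSpace ℝ (Fin d) → EuclideanSpace ℝ (Fin d))
    (hf : ∀ k ∈ Finset.Icc 1 n, Measurable (f k))
    -- the random variables driving the comparison process
    {Ω : Type*} [MeasurableSpace Ω] (P : Measure Ω) [IsProbabilityMeasure P]
    (X : Ω → EuclideanSpace ℝ (Fin d)) (hX : Measurable X) (hXμ : HasLaw X μ P)
    (N : ℕ → Ω → EuclideanSpace ℝ (Fin d))
    (hN : ∀ k ∈ Finset.Icc 1 n, Measurable (N k))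
    (hN_law : ∀ k ∈ Finset.Icc 1 n, HasLaw (N k) (stdGaussian (EuclideanSpace ℝ (Fin d))) P)
    (hN_indep : iIndepFun (fun k : Fin n => N (k + 1)) P)
    (hXN : IndepFun X (fun ω (k : Fin n) => N (k + 1) ω) P)
    -- the noise driving the sampling process, possibly on another probability space
    {Ω' : Type*} [MeasurableSpace Ω'] (P' : Measure Ω') [IsProbabilityMeasure P']
    (N' : ℕ → Ω' → EuclideanSpace ℝ (Fin d))
    (hN' : ∀ k ∈ Finset.Icc 1 n, Measurable (N' k))
    (hN'_law : ∀ k ∈ Finset.Icc 1 n, HasLaw (N' k) (stdGaussian (EuclideanSpace ℝ (Fin d))) P')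
    (hN'_indep : iIndepFun (fun k : Fin n => N' (k + 1)) P')
    -- `f_k(Y_{k-1})` is square-integrable
    (hfY : ∀ k ∈ Finset.Icc 1 n,
      Integrable (fun ω => ‖f k (comparisonProcess δ X N (k - 1) ω)‖ ^ 2) P) :
    InformationTheory.klDiv
        (pathLaw P (comparisonProcess δ X N) n) (pathLaw P' (samplingProcess δ f N') n) ≤
      ENNReal.ofReal
        ((Finset.Icc 1 n).sup' (Finset.nonempty_Icc.2 hn) δ / 2 * (covarianceMatrix X P).trace +
          ∑ k ∈ Finset.Icc 1 n, δ k / 2 *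
            ∫ ω, ‖f k (comparisonProcess δ X N (k - 1) ω) -
              (P[X | MeasurableSpace.comap (comparisonProcess δ X N (k - 1)) inferInstance]) ω‖ ^ 2
              ∂P) := by
  have hmem : ∀ k < n, k + 1 ∈ Finset.Icc 1 n := fun k hk => by simp; omega
  have hXmap : P.map X = μ := hXμ.map_eq
  have hX2 : MemLp X 2 P := by
    rw [memLp_two_iff_integrable_sq_norm hX.aestronglyMeasurable]
    rw [← hXmap] at hμ
    exact (integrable_map_measure (f := X) (by fun_prop) hX.aemeasurable).1 hμ
  have hnoise := isGaussianNoise_of_iIndepFun hN hN_law hN_indep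
  have hnoise' := isGaussianNoise_of_iIndepFun hN' hN'_law hN'_indep
  have hδ' : ∀ k < n, 0 ≤ δ (k + 1) := fun k hk => (hδ _ (hmem k hk)).le
  have hf' : ∀ k < n, Measurable (f (k + 1)) := fun k hk => hf _ (hmem k hk)
  have hfY' : ∀ k < n, MemLp (fun ω => f (k + 1) (comparisonProcess δ X N k ω)) 2 P := by
    intro k hk
    have hm : Measurable fun ω => f (k + 1) (comparisonProcess δ X N k ω) :=
      (hf' k hk).comp (measurable_comparisonProcess hX hnoise hk.le)
    exact (memLp_two_iff_integrable_sq_norm hm.aestronglyMeasurable).2 (hfY _ (hmem k hk))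
  refine (klDiv_pathLaw_le hX hX2 hnoise hXN hδ' hnoise' hf' hfY').trans
    (ENNReal.ofReal_le_ofReal ?_)
  rw [(integral_logGirsanov_comparisonProcess hX hX2 hnoise hXN hf' hfY').2,
    sum_Icc_one_eq_sum_range, trace_covarianceMatrix hX2, hXmap]
  have hM : ∀ k ∈ Finset.Icc 1 n, δ k ≤ (Finset.Icc 1 n).sup' (Finset.nonempty_Icc.2 hn) δ :=
    fun k hk => Finset.le_sup' δ hk
  have hent := channelEntropy_elapsedTime_le hμ hδ
    ((hδ 1 (by simp; omega)).le.trans (hM 1 (by simp; omega))) hM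
  have e1 : ∫ x, ‖x‖ ^ 2 ∂μ = ∫ ω, ‖X ω‖ ^ 2 ∂P := by
    rw [← hXmap, integral_map hX.aemeasurable (by fun_prop)]
  have e2 : ∫ x, x ∂μ = ∫ ω, X ω ∂P := by
    rw [← hXmap, integral_map hX.aemeasurable (by fun_prop)]
  rw [e1, e2] at hent
  have hsum := Finset.sum_le_sum fun k (hk : k ∈ Finset.range n) => by
    have hk' : k < n := by simpa using hk
    have h := posteriorEnergy_le_condExp hX (by rwa [hXmap]) hnoise hXN hδ' hk'.le
    rw [hXmap] at h
    exact mul_le_mul_of_nonneg_left h (div_nonneg (hδ' k hk') zero_le_two)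
  simp only [mul_sub, Finset.sum_sub_distrib, add_tsub_cancel_right] at hent hsum ⊢
  linarith
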